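/- **Notation.** All functions are complex-valued on $(-1,1)$. $AC_{\mathrm{loc}}(-1,1)$ denotes the functions that are absolutely continuous on every compact subinterval of $(-1,1)$; limits at $\pm1$ are taken from inside $(-1,1)$. Put $$\ell[y]=-\big((1-x^2)y'\big)',\qquad \ell^2[y]=\big((1-x^2)^2y''\big)''-2\big((1-x^2)y'\big)',$$ $$\Delta_{1,\max}=\{f: f,f'\in AC_{\mathrm{loc}}(-1,1);\ f,\ell[f]\in L^2(-1,1)\},$$ $$\Delta_{2,\max}=\{f: f,f',f'',f'''\in AC_{\mathrm{loc}}(-1,1);\ f,\ell^2[f]\in L^2(-1,1)\},$$ and for sufficiently regular $f,g$ $$\begin{aligned}[f,g]_2(x)={}&\big((1-x^2)^2f''\big)'\,\overline g-\big((1-x^2)^2\overline g''\big)'f-(1-x^2)^2f''\,\overline g'+(1-x^2)^2f'\,\overline g''\\&-2(1-x^2)f'\,\overline g+2(1-x^2)f\,\overline g'.\end{aligned}$$ The Legendre polynomials operator $A$ in $L^2(-1,1)$ is $Af=\ell[f]$ with domain $$\mathcal D(A)=\{f\in\Delta_{1,\max}:\ \lim_{x\to\pm1}(1-x^2)f'(x)=0\}.$$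 Let $T=A^2$ be its square, with domain $\mathcal D(T)=\mathcal D(A^2)=\{f\in\mathcal D(A): Af\in\mathcal D(A)\}$. **Theorem 4.4.** For a function $f:(-1,1)\to\mathbb C$ the following statements are equivalent: (i) $f\in\mathcal D(A^2)$; (ii) $f,f',f'',f'''\in AC_{\mathrm{loc}}(-1,1)$ and $(1-x^2)^2f^{(4)}\in L^2(-1,1)$; (iii) $f\in\Delta_{2,\max}$ and $\lim_{x\to\pm1}[f,1]_2(x)=\lim_{x\to\pm1}[f,x]_2(x)=0$; (iv) $f\in\Delta_{2,\max}$ and $\lim_{x\to\pm1}(1-x^2)f'(x)=\lim_{x\to\pm1}\big((1-x^2)^2f''(x)\big)'=0$. Moreover, $Tf=\ell^2[f]$ almost everywhere for every $f\in\mathcal D(T)$; $T$ is a self-adjoint operator in $L^2(-1,1)$; each Legendre polynomial $P_n$ ($n=0,1,2,\dots$) is an eigenfunction of $T$, with $TP_n=n^2(n+1)^2P_n$, and the $P_n$ are complete, that is, their linear span is dense in $L^2(-1,1)$; the spectrum of $T$ is discrete (it consists of isolated eigenvalues of finite multiplicity), and $$\sigma(T)=\{n^2(n+1)^2: n=0,1,2,\dots\}.$$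 -/

import Mathlib

open MeasureTheory Set Filter Topology Polynomial

noncomputable section

namespace LegendreSquare

/-! ### Functions on the interval `(-1, 1)`

A function `f : (-1,1) → ℂ` is represented by a function `f : ℝ → ℂ`; every notion below only
depends on the values of `f` on the open interval `(-1, 1)`. -/

/-- The interval `(-1, 1)`. -/
abbrev I : Set ℝ := Ioo (-1) 1

/-- Lebesgue measure on `(-1, 1)`. -/
abbrev μI : Measure ℝ := volume.restrict I

/-- The Hilbert space `L²(-1, 1)` of complex-valued functions. -/
abbrev L2 : Type := Lp ℂ 2 μI

/-- The function `f` is square integrable on `(-1, 1)`. -/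
def SqInt (f : ℝ → ℂ) : Prop := MemLp f 2 μI

/-- `f ∈ AC_loc(-1, 1)`: absolute continuity on every compact subinterval of `(-1, 1)`. -/
def ACLoc (f : ℝ → ℂ) : Prop :=
  ∀ a b : ℝ, -1 < a → a < b → b < 1 → AbsolutelyContinuousOnInterval f a b

/-- `f, f', …, f⁽ⁿ⁾` exist everywhere on `(-1, 1)` and all belong to `AC_loc(-1, 1)`. -/
def ACLocUpTo (n : ℕ) (f : ℝ → ℂ) : Prop :=
  (∀ k < n, DifferentiableOn ℝ (iteratedDeriv k f) I) ∧ ∀ k ≤ n, ACLoc (iteratedDeriv k f)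

/-- `lim_{x → ±1} g(x) = 0`, the limits being taken from inside `(-1, 1)`. -/
def VanishesAtEnds (g : ℝ → ℂ) : Prop :=
  Tendsto g (𝓝[<] (1 : ℝ)) (𝓝 0) ∧ Tendsto g (𝓝[>] (-1 : ℝ)) (𝓝 0)

/-! ### The Legendre expression, its formal square, and the maximal domains -/

/-- `ℓ[f] = -((1 - x²) f')'`. -/
def ell (f : ℝ → ℂ) (x : ℝ) : ℂ :=
  -deriv (fun t : ℝ => (1 - (t : ℂ) ^ 2) * deriv f t) x

/-- `ℓ²[f] = ((1 - x²)² f'')'' - 2 ((1 - x²) f')'`. -/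
def ellSq (f : ℝ → ℂ) (x : ℝ) : ℂ :=
  iteratedDeriv 2 (fun t : ℝ => (1 - (t : ℂ) ^ 2) ^ 2 * iteratedDeriv 2 f t) x
    - 2 * deriv (fun t : ℝ => (1 - (t : ℂ) ^ 2) * deriv f t) x

/-- The maximal domain of `ℓ` in `L²(-1, 1)`. -/
def maxDomain₁ : Set (ℝ → ℂ) := {f | ACLocUpTo 1 f ∧ SqInt f ∧ SqInt (ell f)}

/-- The maximal domain of `ℓ²` in `L²(-1, 1)`. -/
def maxDomain₂ : Set (ℝ → ℂ) := {f | ACLocUpTo 3 f ∧ SqInt f ∧ SqInt (ellSq f)}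

/-- The sesquilinear form `[f, g]₂` of Green's formula for `ℓ²`. -/
def form₂ (f g : ℝ → ℂ) (x : ℝ) : ℂ :=
  let g' : ℝ → ℂ := fun t => star (g t)
  deriv (fun t : ℝ => (1 - (t : ℂ) ^ 2) ^ 2 * iteratedDeriv 2 f t) x * g' x
    - deriv (fun t : ℝ => (1 - (t : ℂ) ^ 2) ^ 2 * iteratedDeriv 2 g' t) x * f x
    - (1 - (x : ℂ) ^ 2) ^ 2 * iteratedDeriv 2 f x * deriv g' x
    + (1 - (x : ℂ) ^ 2) ^ 2 * deriv f x * iteratedDeriv 2 g' x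
    - 2 * (1 - (x : ℂ) ^ 2) * deriv f x * g' x
    + 2 * (1 - (x : ℂ) ^ 2) * f x * deriv g' x

/-! ### The Legendre polynomials operator and its square -/

/-- The functions in the domain of the Legendre polynomials operator `A`. -/
def domA : Set (ℝ → ℂ) :=
  {f | f ∈ maxDomain₁ ∧ VanishesAtEnds (fun x : ℝ => (1 - (x : ℂ) ^ 2) * deriv f x)}

/-- The functions in the domain of `A²`: those `f ∈ D(A)` with `A f ∈ D(A)`. -/
def domASq : Set (ℝ → ℂ) := {f | f ∈ domA ∧ ell f ∈ domA}

lemma ACLoc.continuousOn {f : ℝ → ℂ} (hf : ACLoc f) : ContinuousOn f I := by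
  intro x hx
  obtain ⟨a, ha, hax⟩ := exists_between hx.1
  obtain ⟨b, hxb, hb⟩ := exists_between hx.2
  have h := (hf a b ha (hax.trans hxb) hb).continuousOn
  rw [uIcc_of_le (hax.trans hxb).le] at h
  exact (h.continuousAt (Icc_mem_nhds hax hxb)).continuousWithinAt

lemma ACLoc.add {f g : ℝ → ℂ} (hf : ACLoc f) (hg : ACLoc g) : ACLoc (f + g) :=
  fun a b ha hab hb => (hf a b ha hab hb).add (hg a b ha hab hb)

lemma ACLoc.const_smul {f : ℝ → ℂ} (c : ℂ) (hf : ACLoc f) : ACLoc (c • f) :=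
  fun a b ha hab hb => (hf a b ha hab hb).const_smul c

lemma ACLoc.congr {f g : ℝ → ℂ} (hf : ACLoc f) (h : EqOn f g I) : ACLoc g := by
  intro a b ha hab hb
  have hf' := hf a b ha hab hb
  rw [absolutelyContinuousOnInterval_iff] at hf' ⊢
  intro ε hε
  obtain ⟨δ, hδ, H⟩ := hf' ε hε
  refine ⟨δ, hδ, fun E hE hlt => ?_⟩
  have key := H E hE hlt
  have hsub : uIcc a b ⊆ I := by
    rw [uIcc_of_le hab.le]
    exact fun x hx => ⟨ha.trans_le hx.1, hx.2.trans_lt hb⟩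
  refine lt_of_eq_of_lt (Finset.sum_congr rfl fun i hi => ?_) key
  have hm := hE.1 i hi
  rw [h (hsub hm.1), h (hsub hm.2)]

lemma ACLoc.ae_differentiableAt {f : ℝ → ℂ} (hf : ACLoc f) :
    ∀ᵐ x ∂μI, DifferentiableAt ℝ f x := by
  rw [ae_restrict_iff' measurableSet_Ioo]
  have key : ∀ n : ℕ, ∀ᵐ x : ℝ,
      x ∈ uIcc (-1 + 1 / ((n : ℝ) + 2)) (1 - 1 / ((n : ℝ) + 2)) → DifferentiableAt ℝ f x := by
    intro n
    have hpos : (0 : ℝ) < 1 / ((n : ℝ) + 2) := by positivity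
    have h0 : (0 : ℝ) ≤ n := n.cast_nonneg
    have hle : 1 / ((n : ℝ) + 2) ≤ 1 / 2 := by
      apply one_div_le_one_div_of_le <;> linarith
    exact (hf _ _ (by linarith) (by linarith)
      (by linarith)).boundedVariationOn.ae_differentiableAt_of_mem_uIcc
  rw [← ae_all_iff] at key
  filter_upwards [key] with x hx hxI
  have hd : 0 < min (x + 1) (1 - x) := lt_min (by linarith [hxI.1]) (by linarith [hxI.2])
  obtain ⟨n, hn⟩ := exists_nat_one_div_lt hd
  have h2 : 1 / ((n : ℝ) + 2) ≤ 1 / ((n : ℝ) + 1) := by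
    apply one_div_le_one_div_of_le <;> [positivity; linarith]
  have := min_le_left (x + 1) (1 - x)
  have := min_le_right (x + 1) (1 - x)
  refine hx n (Icc_subset_uIcc ⟨by linarith, by linarith⟩)

lemma deriv_eqOn {f g : ℝ → ℂ} (h : EqOn f g I) : EqOn (deriv f) (deriv g) I := fun _ hx =>
  (h.eventuallyEq_of_mem (isOpen_Ioo.mem_nhds hx)).deriv_eq

lemma ell_eqOn {f g : ℝ → ℂ} (h : EqOn f g I) : EqOn (ell f) (ell g) I := by
  have h2 : EqOn (fun t : ℝ => (1 - (t : ℂ) ^ 2) * deriv f t)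
      (fun t : ℝ => (1 - (t : ℂ) ^ 2) * deriv g t) I := fun x hx => by
    simp only [deriv_eqOn h hx]
  intro x hx
  simp only [ell, deriv_eqOn h2 hx]

lemma domA_differentiableAt {f : ℝ → ℂ} (hf : f ∈ domA) {x : ℝ} (hx : x ∈ I) :
    DifferentiableAt ℝ f x := by
  have := hf.1.1.1 0 one_pos
  rw [iteratedDeriv_zero] at this
  exact this.differentiableAt (isOpen_Ioo.mem_nhds hx)

lemma domA_acLoc {f : ℝ → ℂ} (hf : f ∈ domA) : ACLoc f := by
  simpa using hf.1.1.2 0 zero_le_one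

lemma domA_acLoc_deriv {f : ℝ → ℂ} (hf : f ∈ domA) : ACLoc (deriv f) := by
  simpa using hf.1.1.2 1 le_rfl

lemma deriv_add_eqOn {f g : ℝ → ℂ} (hf : f ∈ domA) (hg : g ∈ domA) :
    EqOn (deriv f + deriv g) (deriv (f + g)) I := fun _ hx =>
  (deriv_add (domA_differentiableAt hf hx) (domA_differentiableAt hg hx)).symm

lemma ae_differentiableAt_flux {f : ℝ → ℂ} (hf : f ∈ domA) :
    ∀ᵐ x ∂μI, DifferentiableAt ℝ (fun t : ℝ => (1 - (t : ℂ) ^ 2) * deriv f t) x := by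
  filter_upwards [(domA_acLoc_deriv hf).ae_differentiableAt] with x hx
  have h1 : DifferentiableAt ℝ (fun t : ℝ => (t : ℂ)) x :=
    Complex.ofRealCLM.differentiableAt
  exact ((differentiableAt_const _).sub (h1.pow 2)).mul hx

lemma ell_add_ae {f g : ℝ → ℂ} (hf : f ∈ domA) (hg : g ∈ domA) :
    ell (f + g) =ᵐ[μI] ell f + ell g := by
  filter_upwards [ae_differentiableAt_flux hf, ae_differentiableAt_flux hg,
    ae_restrict_mem measurableSet_Ioo] with x h1 h2 hx
  have h3 : EqOn (fun t : ℝ => (1 - (t : ℂ) ^ 2) * deriv (f + g) t)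
      ((fun t : ℝ => (1 - (t : ℂ) ^ 2) * deriv f t)
        + fun t : ℝ => (1 - (t : ℂ) ^ 2) * deriv g t) I := by
    intro t ht
    have := deriv_add_eqOn hf hg ht
    simp only [Pi.add_apply] at this ⊢
    rw [← this, mul_add]
  simp only [ell, Pi.add_apply, deriv_eqOn h3 hx]
  rw [deriv_add h1 h2, neg_add]

lemma deriv_const_smul_fun (c : ℂ) (f : ℝ → ℂ) : deriv (c • f) = c • deriv f := by
  funext x
  exact deriv_const_mul_field c

lemma ell_const_smul (c : ℂ) (f : ℝ → ℂ) : ell (c • f) = c • ell f := by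
  have : (fun t : ℝ => (1 - (t : ℂ) ^ 2) * deriv (c • f) t)
      = c • fun t : ℝ => (1 - (t : ℂ) ^ 2) * deriv f t := by
    funext t
    simp only [deriv_const_smul_fun, Pi.smul_apply, smul_eq_mul]
    ring
  funext x
  simp only [ell]
  rw [this, deriv_const_smul_fun, Pi.smul_apply, Pi.smul_apply, ell, smul_neg]

lemma left_mem : I ∈ 𝓝[<] (1 : ℝ) := Ioo_mem_nhdsLT (by norm_num)

lemma right_mem : I ∈ 𝓝[>] (-1 : ℝ) := Ioo_mem_nhdsGT (by norm_num)

lemma domA_add {f g : ℝ → ℂ} (hf : f ∈ domA) (hg : g ∈ domA) : f + g ∈ domA := by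
  have hd : EqOn ((fun x : ℝ => (1 - (x : ℂ) ^ 2) * deriv f x)
      + fun x : ℝ => (1 - (x : ℂ) ^ 2) * deriv g x)
      (fun x : ℝ => (1 - (x : ℂ) ^ 2) * deriv (f + g) x) I := by
    intro t ht
    have := deriv_add_eqOn hf hg ht
    simp only [Pi.add_apply] at this ⊢
    rw [← this, mul_add]
  refine ⟨⟨⟨?_, ?_⟩, ?_, ?_⟩, ?_, ?_⟩
  · intro k hk
    obtain rfl : k = 0 := by omega
    rw [iteratedDeriv_zero]
    exact fun x hx => ((domA_differentiableAt hf hx).add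
      (domA_differentiableAt hg hx)).differentiableWithinAt
  · intro k hk
    interval_cases k
    · rw [iteratedDeriv_zero]
      exact (domA_acLoc hf).add (domA_acLoc hg)
    · rw [iteratedDeriv_one]
      exact ((domA_acLoc_deriv hf).add (domA_acLoc_deriv hg)).congr (deriv_add_eqOn hf hg)
  · exact MemLp.add hf.1.2.1 hg.1.2.1
  · exact (memLp_congr_ae (ell_add_ae hf hg)).mpr (MemLp.add hf.1.2.2 hg.1.2.2)
  · have := hf.2.1.add hg.2.1
    rw [add_zero] at this
    exact this.congr' (hd.eventuallyEq_of_mem left_mem)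
  · have := hf.2.2.add hg.2.2
    rw [add_zero] at this
    exact this.congr' (hd.eventuallyEq_of_mem right_mem)

lemma domA_const_smul (c : ℂ) {f : ℝ → ℂ} (hf : f ∈ domA) : c • f ∈ domA := by
  have hd : (fun x : ℝ => (1 - (x : ℂ) ^ 2) * deriv (c • f) x)
      = fun x : ℝ => c * ((1 - (x : ℂ) ^ 2) * deriv f x) := by
    funext t
    simp only [deriv_const_smul_fun, Pi.smul_apply, smul_eq_mul]
    ring
  refine ⟨⟨⟨?_, ?_⟩, ?_, ?_⟩, ?_⟩
  · intro k hk
    obtain rfl : k = 0 := by omega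
    rw [iteratedDeriv_zero]
    exact fun x hx => ((domA_differentiableAt hf hx).const_smul c).differentiableWithinAt
  · intro k hk
    interval_cases k
    · rw [iteratedDeriv_zero]
      exact (domA_acLoc hf).const_smul c
    · rw [iteratedDeriv_one, deriv_const_smul_fun]
      exact (domA_acLoc_deriv hf).const_smul c
  · exact MemLp.const_smul hf.1.2.1 c
  · rw [ell_const_smul]
    exact MemLp.const_smul hf.1.2.2 c
  · rw [hd]
    exact ⟨by simpa using hf.2.1.const_mul c, by simpa using hf.2.2.const_mul c⟩

lemma ell_ae_of_ae {f g : ℝ → ℂ} (hf : f ∈ domA) (hg : g ∈ domA) (h : f =ᵐ[μI] g) :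
    ell f =ᵐ[μI] ell g := by
  have h2 : EqOn f g I := Measure.eqOn_of_ae_eq h (domA_acLoc hf).continuousOn
    (domA_acLoc hg).continuousOn (by rw [isOpen_Ioo.interior_eq]; exact subset_closure)
  filter_upwards [ae_restrict_mem measurableSet_Ioo] with x hx
  exact ell_eqOn h2 hx

/-- The domain of the Legendre polynomials operator `A` in `L²(-1, 1)`: the classes of the functions
in `domA`. -/
def opADomain : Submodule ℂ L2 where
  carrier := {u | ∃ f ∈ domA, u =ᵐ[μI] f}
  zero_mem' := by
    have h : ∀ k : ℕ, iteratedDeriv k (0 : ℝ → ℂ) = 0 := fun k => by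
      funext x
      simp
    have hac : ACLoc 0 := fun a b _ _ _ => by
      simpa [AbsolutelyContinuousOnInterval] using tendsto_const_nhds
    have hell : ell (0 : ℝ → ℂ) = 0 := by
      funext x
      simp [ell]
    refine ⟨0, ⟨⟨⟨fun k _ => ?_, fun k _ => ?_⟩, MemLp.zero, ?_⟩, ?_⟩, Lp.coeFn_zero _ _ _⟩
    · rw [h k]
      exact differentiableOn_const 0
    · rw [h k]
      exact hac
    · rw [hell]
      exact MemLp.zero
    · simp [VanishesAtEnds]
  add_mem' := by
    rintro u v ⟨f, hf, hu⟩ ⟨g, hg, hv⟩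
    exact ⟨f + g, domA_add hf hg, (Lp.coeFn_add u v).trans (hu.add hv)⟩
  smul_mem' := by
    rintro c u ⟨f, hf, hu⟩
    exact ⟨c • f, domA_const_smul c hf, (Lp.coeFn_smul c u).trans (hu.const_smul c)⟩

/-- A representative in `domA` of an element of the domain of `A`. -/
def rep (u : opADomain) : ℝ → ℂ := Classical.choose u.2

lemma rep_mem (u : opADomain) : rep u ∈ domA := (Classical.choose_spec u.2).1

lemma rep_ae (u : opADomain) : (u : L2) =ᵐ[μI] rep u := (Classical.choose_spec u.2).2

/-- The Legendre polynomials operator `A` in `L²(-1, 1)`: it sends the class of `f ∈ domA` to the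
class of `ℓ[f]`. -/
def opA : L2 →ₗ.[ℂ] L2 where
  domain := opADomain
  toFun :=
    { toFun := fun u => MemLp.toLp (ell (rep u)) (rep_mem u).1.2.2
      map_add' := by
        intro u v
        have h : ell (rep (u + v)) =ᵐ[μI] ell (rep u) + ell (rep v) :=
          (ell_ae_of_ae (rep_mem _) (domA_add (rep_mem u) (rep_mem v))
            ((rep_ae (u + v)).symm.trans
              ((Lp.coeFn_add (u : L2) v).trans ((rep_ae u).add (rep_ae v))))).trans
            (ell_add_ae (rep_mem u) (rep_mem v))
        exact (MemLp.toLp_congr _ ((rep_mem u).1.2.2.add (rep_mem v).1.2.2) h).trans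
          (MemLp.toLp_add _ _)
      map_smul' := by
        intro c u
        have h : ell (rep (c • u)) =ᵐ[μI] c • ell (rep u) := by
          rw [← ell_const_smul]
          exact ell_ae_of_ae (rep_mem _) (domA_const_smul c (rep_mem u))
            ((rep_ae (c • u)).symm.trans
              ((Lp.coeFn_smul c (u : L2)).trans ((rep_ae u).const_smul c)))
        exact (MemLp.toLp_congr _ ((rep_mem u).1.2.2.const_smul c) h).trans
          (MemLp.toLp_const_smul c _) }

/-- `A` acts as the Legendre expression, whatever representative in `domA` is used. -/
lemma opA_apply (u : opA.domain) {f : ℝ → ℂ} (hf : f ∈ domA) (h : (u : L2) =ᵐ[μI] f) :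
    opA u =ᵐ[μI] ell f :=
  (MemLp.coeFn_toLp (rep_mem u).1.2.2).trans
    (ell_ae_of_ae (rep_mem u) hf ((rep_ae u).symm.trans h))

/-- The algebraic square of an operator `A`: the composition `A ∘ A` on the domain
`{u ∈ D(A) : A u ∈ D(A)}`. -/
def square {H : Type*} [AddCommGroup H] [Module ℂ H] (A : H →ₗ.[ℂ] H) : H →ₗ.[ℂ] H where
  domain :=
    { carrier := {u | ∃ h : u ∈ A.domain, A ⟨u, h⟩ ∈ A.domain}
      zero_mem' := ⟨A.domain.zero_mem, by
        have : A ⟨0, A.domain.zero_mem⟩ = 0 := A.map_zero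
        rw [this]
        exact A.domain.zero_mem⟩
      add_mem' := by
        rintro u v ⟨hu, hu'⟩ ⟨hv, hv'⟩
        refine ⟨A.domain.add_mem hu hv, ?_⟩
        have := A.map_add ⟨u, hu⟩ ⟨v, hv⟩
        exact this ▸ A.domain.add_mem hu' hv'
      smul_mem' := by
        rintro c u ⟨hu, hu'⟩
        refine ⟨A.domain.smul_mem c hu, ?_⟩
        have := A.map_smul c ⟨u, hu⟩
        exact this ▸ A.domain.smul_mem c hu' }
  toFun :=
    { toFun := fun u => A ⟨A ⟨u, u.2.fst⟩, u.2.snd⟩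
      map_add' := by
        intro u v
        rw [← A.map_add]
        congr 1
        exact Subtype.ext (A.map_add ⟨u, u.2.fst⟩ ⟨v, v.2.fst⟩)
      map_smul' := by
        intro c u
        rw [RingHom.id_apply, ← A.map_smul]
        congr 1
        exact Subtype.ext (A.map_smul c ⟨u, u.2.fst⟩) }

/-- The operator `T = A²`, the square of the Legendre polynomials operator. -/
def opT : L2 →ₗ.[ℂ] L2 := square opA

/-! ### Spectrum of an unbounded operator -/

/-- The spectrum of an operator `T`: the set of those `z` for which `T - z : D(T) → H` has no
bounded everywhere defined inverse. -/
def spectrumOf {H : Type*} [NormedAddCommGroup H] [NormedSpace ℂ H] (T : H →ₗ.[ℂ] H) : Set ℂ :=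
  {z | ¬ ∃ R : H →L[ℂ] H,
    (∀ v : H, ∃ h : R v ∈ T.domain, T ⟨R v, h⟩ - z • R v = v) ∧
    ∀ u : T.domain, R (T u - z • (u : H)) = u}

/-- The eigenspace of `T` at `z`, as a subspace of the domain of `T`. -/
def eigenspaceOf {H : Type*} [NormedAddCommGroup H] [NormedSpace ℂ H] (T : H →ₗ.[ℂ] H) (z : ℂ) :
    Submodule ℂ T.domain :=
  LinearMap.ker (T.toFun - z • T.domain.subtype)

/-- The spectrum of `T` is discrete: each of its points is isolated in the spectrum and is an
eigenvalue of finite multiplicity. -/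
def HasDiscreteSpectrum {H : Type*} [NormedAddCommGroup H] [NormedSpace ℂ H]
    (T : H →ₗ.[ℂ] H) : Prop :=
  ∀ z ∈ spectrumOf T, ¬ AccPt z (𝓟 (spectrumOf T)) ∧
    eigenspaceOf T z ≠ ⊥ ∧ FiniteDimensional ℂ (eigenspaceOf T z)

/-! ### Legendre polynomials -/

/-- The Legendre polynomial `Pₙ = (2ⁿ n!)⁻¹ dⁿ/dxⁿ (x² - 1)ⁿ`. -/
def legendreP (n : ℕ) : ℂ[X] :=
  C ((2 ^ n * (n.factorial : ℂ))⁻¹) * derivative^[n] ((X ^ 2 - 1) ^ n)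

lemma sqInt_polynomial (p : ℂ[X]) : SqInt (fun x : ℝ => p.eval (x : ℂ)) := by
  have hc : Continuous fun x : ℝ => p.eval (x : ℂ) := p.continuous.comp Complex.continuous_ofReal
  obtain ⟨M, hM⟩ := (isCompact_Icc (a := (-1 : ℝ)) (b := 1)).exists_bound_of_continuousOn
    hc.continuousOn
  refine MemLp.of_bound hc.aestronglyMeasurable M ?_
  filter_upwards [ae_restrict_mem measurableSet_Ioo] with x hx
  exact hM x (Ioo_subset_Icc_self hx)

/-- The Legendre polynomial `Pₙ` as an element of `L²(-1, 1)`. -/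
def legendreL2 (n : ℕ) : L2 :=
  MemLp.toLp (fun x : ℝ => (legendreP n).eval (x : ℂ)) (sqInt_polynomial (legendreP n))

end LegendreSquare

end

open MeasureTheory Set Filter Topology Polynomial

noncomputable section

namespace LegendreSquare

/-! ### Calculus of locally absolutely continuous functions -/

/-! Write p = 1 - x². Two arguments run side by side: one identifies the domain, the other
diagonalises the operator.

For the domain, membership in D(A²) means that the fluxes p f' and p (ℓ[f])' vanish at the ends,
with f and ℓ²[f] square integrable. A flux that vanishes at the ends and has an L² derivative can be
divided by p inside L²; this is the Hardy inequality `HasACDeriv.hardy_outer`. Applied to the fluxes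
of f and of ℓ[f], and to p² f'', it gives p² f⁗ ∈ L² (`acLocUpTo_of_domASq`). Conversely,
`HasACDeriv.hardy_inner` descends from p² f⁗ ∈ L² to p f''' and f'' in L², and then f' and f are
bounded (`ACLocUpTo.sqInt_iteratedDeriv`). A function with an L² derivative whose quotient by p is
in L² tends to 0 at the ends (`HasACDeriv.vanishesAtEnds`), so all the end conditions follow. The
way back to D(A²) rests on [f,1]₂ = (p² f'')' - 2p f' = -p (ℓ[f])', which is `ACLocUpTo.form₂_one`,
and on `ACLocUpTo.mem_domASq`.

For the operator, Green's formula makes A symmetric. The Legendre equation and Weierstrass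
approximation provide a Hilbert basis of eigenvectors. Moreover A is the maximal diagonal operator
in that basis (`isDiagonal_opA`): every v of mean zero is A w for some w, found by integrating
twice, so an element u with the right coordinates differs from w by a constant. Maximal diagonality
passes to the square (`IsDiagonal.square`), and it yields self-adjointness and, since the
eigenvalues are separated by at least 1, the discrete spectrum. -/

/-- `h ∈ AC_loc(-1, 1)`, with derivative `r` almost everywhere. -/
def HasACDeriv (h r : ℝ → ℂ) : Prop := ACLoc h ∧ ∀ᵐ x ∂μI, HasDerivAt h (r x) x

/-- Real and imaginary parts, the embedding of ℝ and conjugation are 1-Lipschitz, so complex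
absolute continuity reduces to the real case and back. -/
lemma ac_comp_lipschitz {E F : Type*} [PseudoMetricSpace E] [PseudoMetricSpace F] {f : ℝ → E}
    {φ : E → F} (hφ : ∀ x y, dist (φ x) (φ y) ≤ dist x y) {a b : ℝ}
    (hf : AbsolutelyContinuousOnInterval f a b) :
    AbsolutelyContinuousOnInterval (fun x => φ (f x)) a b := by
  rw [absolutelyContinuousOnInterval_iff] at hf ⊢
  intro ε hε
  obtain ⟨δ, hδ, H⟩ := hf ε hε
  exact ⟨δ, hδ, fun E hE hlt => (Finset.sum_le_sum fun i _ => hφ _ _).trans_lt (H E hE hlt)⟩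

lemma ac_re {f : ℝ → ℂ} {a b : ℝ} (hf : AbsolutelyContinuousOnInterval f a b) :
    AbsolutelyContinuousOnInterval (fun x => (f x).re) a b :=
  ac_comp_lipschitz (fun x y => by
    rw [Real.dist_eq, Complex.dist_eq, ← Complex.sub_re]; exact Complex.abs_re_le_norm _) hf

lemma ac_im {f : ℝ → ℂ} {a b : ℝ} (hf : AbsolutelyContinuousOnInterval f a b) :
    AbsolutelyContinuousOnInterval (fun x => (f x).im) a b :=
  ac_comp_lipschitz (fun x y => by
    rw [Real.dist_eq, Complex.dist_eq, ← Complex.sub_im]; exact Complex.abs_im_le_norm _) hf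

lemma ac_ofReal {f : ℝ → ℝ} {a b : ℝ} (hf : AbsolutelyContinuousOnInterval f a b) :
    AbsolutelyContinuousOnInterval (fun x => (f x : ℂ)) a b :=
  ac_comp_lipschitz (φ := fun x : ℝ => (x : ℂ)) (fun x y => by
    rw [Complex.dist_eq, ← Complex.ofReal_sub, Complex.norm_real, Real.dist_eq,
      Real.norm_eq_abs]) hf

lemma intervalIntegrable_of_re_im {r : ℝ → ℂ} {a b : ℝ}
    (h1 : IntervalIntegrable (fun x => (r x).re) volume a b)
    (h2 : IntervalIntegrable (fun x => (r x).im) volume a b) :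
    IntervalIntegrable r volume a b := by
  have h3 : IntervalIntegrable (fun x => ((r x).re : ℂ)) volume a b := ⟨h1.1.ofReal, h1.2.ofReal⟩
  have h4 : IntervalIntegrable (fun x => ((r x).im : ℂ)) volume a b := ⟨h2.1.ofReal, h2.2.ofReal⟩
  have := h3.add (h4.mul_const Complex.I)
  refine this.congr (fun x _ => ?_)
  exact Complex.re_add_im (r x)

lemma IntervalIntegrable.ac_integral {r : ℝ → ℂ} {a b c : ℝ}
    (h : IntervalIntegrable r volume a b) (hc : c ∈ uIcc a b) :
    AbsolutelyContinuousOnInterval (fun x => ∫ t in c..x, r t) a b := by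
  have h1 : IntervalIntegrable (fun x => (r x).re) volume a b := ⟨h.1.re, h.2.re⟩
  have h2 : IntervalIntegrable (fun x => (r x).im) volume a b := ⟨h.1.im, h.2.im⟩
  have h3 := (ac_ofReal (h1.absolutelyContinuousOnInterval_intervalIntegral hc)).add
    ((ac_ofReal (h2.absolutelyContinuousOnInterval_intervalIntegral hc)).const_smul Complex.I)
  rw [absolutelyContinuousOnInterval_iff] at h3 ⊢
  intro ε hε
  obtain ⟨δ, hδ, H⟩ := h3 ε hε
  refine ⟨δ, hδ, fun E hE hlt => (Finset.sum_congr rfl fun i hi => ?_).trans_lt (H E hE hlt)⟩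
  have key : ∀ x ∈ uIcc a b, ∫ t in c..x, r t
      = ((∫ t in c..x, (r t).re : ℝ) : ℂ) + Complex.I • ((∫ t in c..x, (r t).im : ℝ) : ℂ) := by
    intro x hx
    have hsub : uIcc c x ⊆ uIcc a b := uIcc_subset_uIcc hc hx
    have hr := h.mono_set hsub
    have i1 : IntervalIntegrable (fun x => ((r x).re : ℂ)) volume c x :=
      ⟨hr.1.re.ofReal, hr.2.re.ofReal⟩
    have i2 : IntervalIntegrable (fun x => ((r x).im : ℂ)) volume c x :=
      ⟨hr.1.im.ofReal, hr.2.im.ofReal⟩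
    have i3 : IntervalIntegrable (fun x => Complex.I • ((r x).im : ℂ)) volume c x :=
      i2.smul Complex.I
    rw [← intervalIntegral.integral_ofReal, ← intervalIntegral.integral_ofReal,
      ← intervalIntegral.integral_smul, ← intervalIntegral.integral_add i1 i3]
    refine intervalIntegral.integral_congr fun t _ => ?_
    simp only [smul_eq_mul]
    rw [mul_comm]
    exact (Complex.re_add_im (r t)).symm
  have hm := hE.1 i hi
  simp only [Pi.add_apply]
  rw [key _ hm.1, key _ hm.2]

lemma Icc_subset_I {a b : ℝ} (ha : -1 < a) (hb : b < 1) : Icc a b ⊆ I :=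
  fun _ hx => ⟨ha.trans_le hx.1, hx.2.trans_lt hb⟩

lemma ae_I_iff {q : ℝ → Prop} : (∀ᵐ x ∂μI, q x) ↔ ∀ᵐ x : ℝ, x ∈ I → q x :=
  ae_restrict_iff' measurableSet_Ioo

namespace HasACDeriv

variable {h r k s : ℝ → ℂ}

lemma continuousOn (H : HasACDeriv h r) : ContinuousOn h I := H.1.continuousOn

lemma intervalIntegrable (H : HasACDeriv h r) {a b : ℝ} (ha : a ∈ I) (hb : b ∈ I) :
    IntervalIntegrable r volume a b := by
  wlog hab : a ≤ b generalizing a b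
  · exact (this hb ha (le_of_not_ge hab)).symm
  rcases hab.eq_or_lt with rfl | hab
  · exact IntervalIntegrable.refl
  have hac := H.1 a b ha.1 hab hb.2
  have hae : ∀ᵐ x : ℝ, x ∈ uIoc a b → HasDerivAt h (r x) x := by
    filter_upwards [ae_I_iff.1 H.2] with x hx hxm
    rw [uIoc_of_le hab.le] at hxm
    exact hx ⟨ha.1.trans hxm.1, hxm.2.trans_lt hb.2⟩
  have h1 := (ac_re hac).intervalIntegrable_deriv
  have h2 := (ac_im hac).intervalIntegrable_deriv
  refine intervalIntegrable_of_re_im (h1.congr_ae ?_) (h2.congr_ae ?_)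
  · rw [Filter.EventuallyEq, ae_restrict_iff' measurableSet_uIoc]
    filter_upwards [hae] with x hx hxm
    exact (Complex.reCLM.hasFDerivAt.comp_hasDerivAt x (hx hxm)).deriv
  · rw [Filter.EventuallyEq, ae_restrict_iff' measurableSet_uIoc]
    filter_upwards [hae] with x hx hxm
    exact (Complex.imCLM.hasFDerivAt.comp_hasDerivAt x (hx hxm)).deriv

lemma integral_eq_sub (H : HasACDeriv h r) {a b : ℝ} (ha : a ∈ I) (hb : b ∈ I) :
    ∫ t in a..b, r t = h b - h a := by
  wlog hab : a ≤ b generalizing a b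
  · rw [intervalIntegral.integral_symm, this hb ha (le_of_not_ge hab), neg_sub]
  rcases hab.eq_or_lt with rfl | hab
  · simp
  have hi := H.intervalIntegrable ha hb
  -- The difference of h and the primitive of r is absolutely continuous with derivative 0 almost
  -- everywhere, hence constant.
  have hac := (H.1 a b ha.1 hab hb.2).sub (IntervalIntegrable.ac_integral hi left_mem_uIcc)
  have hae : ∀ᵐ x, x ∈ uIcc a b → HasDerivAt (h - fun x => ∫ t in a..x, r t) 0 x := by
    filter_upwards [ae_I_iff.1 H.2, hi.ae_hasDerivAt_integral] with x hx1 hx2 hxm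
    have hxI : x ∈ I := Icc_subset_I ha.1 hb.2 (by rwa [uIcc_of_le hab.le] at hxm)
    have := (hx1 hxI).sub (hx2 hxm a left_mem_uIcc)
    rwa [sub_self] at this
  obtain ⟨C, hC⟩ := hac.const_of_ae_hasDerivAt_zero hae
  have e1 := hC a left_mem_uIcc
  have e2 := hC b right_mem_uIcc
  simp only [Pi.sub_apply, intervalIntegral.integral_same, sub_zero] at e1 e2
  rw [e1, ← e2]
  ring

lemma congr_left (H : HasACDeriv h r) (hk : EqOn h k I) : HasACDeriv k r := by
  refine ⟨H.1.congr hk, ?_⟩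
  filter_upwards [H.2, ae_restrict_mem measurableSet_Ioo] with x hx hxI
  exact hx.congr_of_eventuallyEq (hk.symm.eventuallyEq_of_mem (isOpen_Ioo.mem_nhds hxI))

lemma congr_right (H : HasACDeriv h r) (hk : r =ᵐ[μI] s) : HasACDeriv h s := by
  refine ⟨H.1, ?_⟩
  filter_upwards [H.2, hk] with x hx hxI
  rwa [← hxI]

lemma congr_right_on (H : HasACDeriv h r) (hk : EqOn r s I) : HasACDeriv h s :=
  H.congr_right (by
    filter_upwards [ae_restrict_mem measurableSet_Ioo] with x hx using hk hx)

lemma deriv_ae (H : HasACDeriv h r) : deriv h =ᵐ[μI] r := by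
  filter_upwards [H.2] with x hx using hx.deriv

lemma add (H : HasACDeriv h r) (K : HasACDeriv k s) :
    HasACDeriv (fun x => h x + k x) (fun x => r x + s x) := by
  refine ⟨H.1.add K.1, ?_⟩
  filter_upwards [H.2, K.2] with x hx hk using hx.add hk

lemma mul (H : HasACDeriv h r) (K : HasACDeriv k s) :
    HasACDeriv (fun x => h x * k x) (fun x => r x * k x + h x * s x) := by
  refine ⟨fun a b ha hab hb => (H.1 a b ha hab hb).smul (K.1 a b ha hab hb), ?_⟩
  filter_upwards [H.2, K.2] with x hx hk using hx.mul hk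

lemma const_mul (H : HasACDeriv h r) (c : ℂ) :
    HasACDeriv (fun x => c * h x) (fun x => c * r x) := by
  refine ⟨fun a b ha hab hb => (H.1 a b ha hab hb).const_smul c, ?_⟩
  filter_upwards [H.2] with x hx using hx.const_mul c

lemma sub (H : HasACDeriv h r) (K : HasACDeriv k s) :
    HasACDeriv (fun x => h x - k x) (fun x => r x - s x) := by
  refine ⟨fun a b ha hab hb => (H.1 a b ha hab hb).sub (K.1 a b ha hab hb), ?_⟩
  filter_upwards [H.2, K.2] with x hx hk using hx.sub hk

lemma conj (H : HasACDeriv h r) :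
    HasACDeriv (fun x => star (h x)) (fun x => star (r x)) := by
  refine ⟨fun a b ha hab hb => ac_comp_lipschitz (φ := fun z : ℂ => star z)
    (fun x y => by rw [dist_star_star]) (H.1 a b ha hab hb), ?_⟩
  filter_upwards [H.2] with x hx using hx.star

lemma of_hasDerivAt (H : ∀ x ∈ I, HasDerivAt h (r x) x) (hr : ContinuousOn r I) :
    HasACDeriv h r := by
  refine ⟨fun a b ha hab hb => ?_, ?_⟩
  · have hsub : uIcc a b ⊆ I := by
      rw [uIcc_of_le hab.le]
      exact Icc_subset_I ha hb
    have : IntervalIntegrable r volume a b := (hr.mono hsub).intervalIntegrable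
    have hac := IntervalIntegrable.ac_integral this left_mem_uIcc
    have hc : AbsolutelyContinuousOnInterval (fun _ : ℝ => h a) a b := by
      simpa [AbsolutelyContinuousOnInterval] using tendsto_const_nhds
    have h2 := hac.add hc
    rw [absolutelyContinuousOnInterval_iff] at h2 ⊢
    intro ε hε
    obtain ⟨δ, hδ, G⟩ := h2 ε hε
    refine ⟨δ, hδ, fun E hE hlt => (Finset.sum_congr rfl fun i hi => ?_).trans_lt (G E hE hlt)⟩
    have key : ∀ x ∈ uIcc a b, h x = (∫ t in a..x, r t) + h a := by
      intro x hx
      have hs : uIcc a x ⊆ uIcc a b := uIcc_subset_uIcc left_mem_uIcc hx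
      rw [intervalIntegral.integral_eq_sub_of_hasDerivAt (fun t ht => H t (hsub (hs ht)))
        (this.mono_set hs), sub_add_cancel]
    have hm := hE.1 i hi
    simp only [Pi.add_apply]
    rw [key _ hm.1, key _ hm.2]
  · filter_upwards [ae_restrict_mem measurableSet_Ioo] with x hx using H x hx

lemma of_integrable (hr : IntegrableOn r I) : HasACDeriv (fun x => ∫ t in (-1 : ℝ)..x, r t) r := by
  have hI : IntervalIntegrable r volume (-1) 1 := by
    rw [intervalIntegrable_iff, uIoc_of_le (by norm_num)]
    exact (integrableOn_Ioc_iff_integrableOn_Ioo (by simp)).2 hr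
  have hu : uIcc (-1 : ℝ) 1 = Icc (-1) 1 := uIcc_of_le (by norm_num)
  refine ⟨fun a b ha hab hb => ?_, ?_⟩
  · refine (IntervalIntegrable.ac_integral hI left_mem_uIcc).mono ?_
    rw [uIcc_of_le hab.le, hu]
    exact Icc_subset_Icc ha.le hb.le
  · rw [ae_I_iff]
    filter_upwards [hI.ae_hasDerivAt_integral] with x hx hxI
    refine hx (hu ▸ Ioo_subset_Icc_self hxI) _ left_mem_uIcc

/-- If the almost everywhere derivative is continuous, it is the derivative. -/
lemma hasDerivAt (H : HasACDeriv h r) (hr : ContinuousOn r I) {x : ℝ} (hx : x ∈ I) :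
    HasDerivAt h (r x) x := by
  have h0 : (0 : ℝ) ∈ I := by constructor <;> norm_num
  have h1 : EqOn h (fun y => h 0 + ∫ t in (0 : ℝ)..y, r t) I := fun y hy => by
    simp only [H.integral_eq_sub h0 hy]; ring
  have h2 : HasDerivAt (fun y => h 0 + ∫ t in (0 : ℝ)..y, r t) (r x) x := by
    refine HasDerivAt.const_add _ ?_
    refine intervalIntegral.integral_hasDerivAt_right (H.intervalIntegrable h0 hx) ?_
      (hr.continuousAt (isOpen_Ioo.mem_nhds hx))
    exact hr.stronglyMeasurableAtFilter isOpen_Ioo x hx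
  exact h2.congr_of_eventuallyEq (h1.eventuallyEq_of_mem (isOpen_Ioo.mem_nhds hx))

lemma const (c : ℂ) : HasACDeriv (fun _ => c) (fun _ => 0) :=
  of_hasDerivAt (fun x _ => hasDerivAt_const x c) continuousOn_const

end HasACDeriv

lemma ACLoc.hasACDeriv {h : ℝ → ℂ} (H : ACLoc h) : HasACDeriv h (deriv h) :=
  ⟨H, H.ae_differentiableAt.mono fun _ hx => hx.hasDerivAt⟩

/-! ### Square integrability, end limits and Hardy inequalities -/

lemma zero_mem_I : (0 : ℝ) ∈ I := by constructor <;> norm_num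

lemma weight_pos {x : ℝ} (hx : x ∈ I) : 0 < 1 - x ^ 2 := by nlinarith [hx.1, hx.2]

lemma weight_ne {x : ℝ} (hx : x ∈ I) : (1 - (x : ℂ) ^ 2) ≠ 0 := by
  have := (weight_pos hx).ne'
  exact_mod_cast this

lemma norm_weight {x : ℝ} (hx : x ∈ I) : ‖(1 - (x : ℂ) ^ 2)‖ = 1 - x ^ 2 := by
  have : (1 - (x : ℂ) ^ 2) = ((1 - x ^ 2 : ℝ) : ℂ) := by push_cast; ring
  rw [this, Complex.norm_real, Real.norm_of_nonneg (weight_pos hx).le]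

lemma aestronglyMeasurable_of_continuousOn {h : ℝ → ℂ} (hc : ContinuousOn h I) :
    AEStronglyMeasurable h μI := hc.aestronglyMeasurable measurableSet_Ioo

lemma SqInt.congr_on {f g : ℝ → ℂ} (hf : SqInt f) (h : EqOn f g I) : SqInt g :=
  (memLp_congr_ae (by
    filter_upwards [ae_restrict_mem measurableSet_Ioo] with x hx using h hx)).1 hf

lemma SqInt.congr_ae {f g : ℝ → ℂ} (hf : SqInt f) (h : f =ᵐ[μI] g) : SqInt g :=
  (memLp_congr_ae h).1 hf

lemma SqInt.add' {f g : ℝ → ℂ} (hf : SqInt f) (hg : SqInt g) : SqInt (fun x => f x + g x) :=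
  MemLp.add hf hg

lemma SqInt.sub' {f g : ℝ → ℂ} (hf : SqInt f) (hg : SqInt g) : SqInt (fun x => f x - g x) :=
  MemLp.sub hf hg

lemma SqInt.neg' {f : ℝ → ℂ} (hf : SqInt f) : SqInt (fun x => - f x) := MemLp.neg hf

lemma SqInt.mul_bdd {f g : ℝ → ℂ} {C : ℝ} (hf : SqInt f) (hg : ContinuousOn g I)
    (hC : ∀ x ∈ I, ‖g x‖ ≤ C) : SqInt (fun x => g x * f x) := by
  refine MemLp.of_le_mul (c := C) hf
    ((aestronglyMeasurable_of_continuousOn hg).mul hf.1) ?_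
  filter_upwards [ae_restrict_mem measurableSet_Ioo] with x hx
  rw [norm_mul]
  exact mul_le_mul_of_nonneg_right (hC x hx) (norm_nonneg _)

lemma SqInt.mul_continuous {f g : ℝ → ℂ} (hf : SqInt f) (hg : Continuous g) :
    SqInt (fun x => g x * f x) := by
  obtain ⟨M, hM⟩ := (isCompact_Icc (a := (-1 : ℝ)) (b := 1)).exists_bound_of_continuousOn
    hg.continuousOn
  exact hf.mul_bdd hg.continuousOn fun x hx => hM x (Ioo_subset_Icc_self hx)

lemma sqInt_of_bdd {f : ℝ → ℂ} {C : ℝ} (hf : ContinuousOn f I) (hC : ∀ x ∈ I, ‖f x‖ ≤ C) :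
    SqInt f := by
  refine MemLp.of_bound (aestronglyMeasurable_of_continuousOn hf) C ?_
  filter_upwards [ae_restrict_mem measurableSet_Ioo] with x hx using hC x hx

lemma SqInt.integrableOn {f : ℝ → ℂ} (hf : SqInt f) : IntegrableOn f I :=
  MemLp.integrable (by norm_num) hf

lemma SqInt.integrableOn_sq {f : ℝ → ℂ} (hf : SqInt f) : IntegrableOn (fun x => ‖f x‖ ^ 2) I :=
  (memLp_two_iff_integrable_sq_norm hf.1).1 hf

lemma Ioc_subset_I {a b : ℝ} (ha : -1 ≤ a) (hb : b < 1) : Ioc a b ⊆ I :=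
  fun _ hx => ⟨ha.trans_lt hx.1, hx.2.trans_lt hb⟩

lemma IntegrableOn.intervalIntegrable_I {f : ℝ → ℝ} (hf : IntegrableOn f I) {a b : ℝ}
    (hab : a ≤ b) (ha : a ∈ I) (hb : b ∈ I) : IntervalIntegrable f volume a b := by
  rw [intervalIntegrable_iff, uIoc_of_le hab]
  exact hf.mono_set (Ioc_subset_I ha.1.le hb.2)

lemma SqInt.interval_le {f : ℝ → ℂ} (hf : SqInt f) {a b : ℝ} (hab : a ≤ b) (ha : a ∈ I)
    (hb : b ∈ I) : ∫ x in a..b, ‖f x‖ ^ 2 ≤ ∫ x in I, ‖f x‖ ^ 2 := by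
  rw [intervalIntegral.integral_of_le hab]
  refine setIntegral_mono_set hf.integrableOn_sq ?_ ?_
  · exact Eventually.of_forall fun x => by positivity
  · exact (Ioc_subset_I ha.1.le hb.2).eventuallyLE

/-- Bounds on the symmetric intervals [-b, b] suffice, because they exhaust (-1,1). Every Hardy
inequality below is proved in this truncated form, where all integrals are finite beforehand. -/
lemma sqInt_of_interval_le {f : ℝ → ℂ} (hf : ContinuousOn f I) {B : ℝ}
    (hB : ∀ b : ℝ, 0 ≤ b → b < 1 → ∫ x in (-b)..b, ‖f x‖ ^ 2 ≤ B) : SqInt f := by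
  have hm := aestronglyMeasurable_of_continuousOn hf
  refine (memLp_two_iff_integrable_sq_norm hm).2 ?_
  let b : ℕ → ℝ := fun n => 1 - 1 / ((n : ℝ) + 1)
  have hb0 : ∀ n, 0 ≤ b n := fun n => by
    have h0 : (0 : ℝ) ≤ n := n.cast_nonneg
    have : 1 / ((n : ℝ) + 1) ≤ 1 := by
      rw [div_le_one (by positivity)]
      linarith
    simp only [b]
    linarith
  have hb1 : ∀ n, b n < 1 := fun n => by
    have : (0 : ℝ) < 1 / ((n : ℝ) + 1) := by positivity
    simp only [b]
    linarith
  have hbt : Tendsto b atTop (𝓝 1) := by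
    simpa [b] using (tendsto_const_nhds (x := (1 : ℝ))).sub tendsto_one_div_add_atTop_nhds_zero_nat
  have hbt' : Tendsto (fun n => -b n) atTop (𝓝 (-1)) := hbt.neg
  have hsub : ∀ n, Icc (-b n) (b n) ⊆ I := fun n =>
    Icc_subset_I (by linarith [hb1 n]) (hb1 n)
  have hint : ∀ n, IntegrableOn (fun x => ‖f x‖ ^ 2) (Ioc (-b n) (b n)) := fun n =>
    (((hf.mono (hsub n)).norm.pow 2).integrableOn_compact isCompact_Icc).mono_set Ioc_subset_Icc_self
  refine (aecover_Ioo_of_Ioc hbt' hbt).integrable_of_integral_bounded_of_nonneg_ae B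
    (fun n => (hint n).restrict) (Eventually.of_forall fun x => by positivity)
    (Eventually.of_forall fun n => ?_)
  rw [Measure.restrict_restrict measurableSet_Ioc, inter_eq_left.2
    (Ioc_subset_Icc_self.trans (hsub n)), ← intervalIntegral.integral_of_le (by linarith [hb0 n])]
  exact hB _ (hb0 n) (hb1 n)

/-- Cauchy–Schwarz against the constant 1, obtained by expanding the integral of (‖f‖ - t)² ≥ 0 with
t the mean of ‖f‖. -/
lemma sq_integral_norm_le {f : ℝ → ℂ} {a b : ℝ} (hab : a < b)
    (h1 : IntervalIntegrable f volume a b)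
    (h2 : IntervalIntegrable (fun x => ‖f x‖ ^ 2) volume a b) :
    (∫ x in a..b, ‖f x‖) ^ 2 ≤ (b - a) * ∫ x in a..b, ‖f x‖ ^ 2 := by
  set J := ∫ x in a..b, ‖f x‖ with hJ
  have hpos : 0 < b - a := sub_pos.2 hab
  set t := J / (b - a) with ht
  have e : ∫ x in a..b, (‖f x‖ - t) ^ 2 = (∫ x in a..b, ‖f x‖ ^ 2) - 2 * t * J + t ^ 2 * (b - a) := by
    have : ∀ x, (‖f x‖ - t) ^ 2 = ‖f x‖ ^ 2 - 2 * t * ‖f x‖ + t ^ 2 := fun x => by ring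
    simp only [this]
    rw [intervalIntegral.integral_add (h2.sub (h1.norm.const_mul _)) (by simp),
      intervalIntegral.integral_sub h2 (h1.norm.const_mul _),
      intervalIntegral.integral_const_mul, intervalIntegral.integral_const, smul_eq_mul]
    ring
  have h0 : 0 ≤ ∫ x in a..b, (‖f x‖ - t) ^ 2 :=
    intervalIntegral.integral_nonneg hab.le fun x _ => sq_nonneg _
  have h3 : t * (b - a) = J := by rw [ht]; field_simp
  rw [e] at h0
  nlinarith

namespace HasACDeriv

variable {h r : ℝ → ℂ}

/-- Up to a constant, h is the primitive of r from -1, which is continuous on the closed interval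
[-1,1]. -/
lemma exists_limits (H : HasACDeriv h r) (hr : IntegrableOn r I) :
    ∃ A B : ℂ, Tendsto h (𝓝[<] (1 : ℝ)) (𝓝 B) ∧ Tendsto h (𝓝[>] (-1 : ℝ)) (𝓝 A) ∧
      (∫ x in I, r x) = B - A ∧ ∃ C, ∀ x ∈ I, ‖h x‖ ≤ C := by
  have hI : IntegrableOn r (Icc (-1) 1) :=
    (integrableOn_Icc_iff_integrableOn_Ioo (by simp) (by simp)).2 hr
  have hu : uIcc (-1 : ℝ) 1 = Icc (-1) 1 := uIcc_of_le (by norm_num)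
  have hii : IntervalIntegrable r volume (-1) 1 := by
    rw [intervalIntegrable_iff_integrableOn_Icc_of_le (by norm_num)]
    exact hI
  set c := h 0 - ∫ t in (-1 : ℝ)..0, r t with hc
  set g : ℝ → ℂ := fun x => c + ∫ t in (-1 : ℝ)..x, r t with hg
  have hgc : ContinuousOn g (Icc (-1) 1) := by
    refine continuousOn_const.add ?_
    have := intervalIntegral.continuousOn_primitive_interval (a := (-1 : ℝ)) (b := 1) (f := r)
      (by rwa [hu])
    rwa [hu] at this
  have heq : EqOn g h I := fun x hx => by
    have hsx : uIcc (-1) x ⊆ uIcc (-1 : ℝ) 1 :=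
      uIcc_subset_uIcc left_mem_uIcc (hu ▸ Ioo_subset_Icc_self hx)
    have hs0 : uIcc (-1) 0 ⊆ uIcc (-1 : ℝ) 1 :=
      uIcc_subset_uIcc left_mem_uIcc (hu ▸ Ioo_subset_Icc_self zero_mem_I)
    have e1 := H.integral_eq_sub zero_mem_I hx
    rw [← intervalIntegral.integral_interval_sub_left (hii.mono_set hsx) (hii.mono_set hs0)] at e1
    simp only [hg, hc]
    linear_combination e1
  have t1 : Tendsto g (𝓝[<] 1) (𝓝 (g 1)) := by
    have := (hgc 1 (by simp)).mono_left (nhdsWithin_mono _ Ioo_subset_Icc_self)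
    rwa [nhdsWithin_Ioo_eq_nhdsLT (by norm_num)] at this
  have t2 : Tendsto g (𝓝[>] (-1)) (𝓝 (g (-1))) := by
    have := (hgc (-1) (by simp)).mono_left (nhdsWithin_mono _ Ioo_subset_Icc_self)
    rwa [nhdsWithin_Ioo_eq_nhdsGT (by norm_num)] at this
  obtain ⟨C, hC⟩ := isCompact_Icc.exists_bound_of_continuousOn hgc
  refine ⟨g (-1), g 1, t1.congr' (heq.eventuallyEq_of_mem left_mem),
    t2.congr' (heq.eventuallyEq_of_mem right_mem), ?_, C, fun x hx => ?_⟩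
  · simp only [hg, intervalIntegral.integral_same, add_zero, add_sub_cancel_left]
    rw [intervalIntegral.integral_of_le (by norm_num), integral_Ioc_eq_integral_Ioo]
  · rw [← heq hx]
    exact hC x (Ioo_subset_Icc_self hx)

lemma exists_bound (H : HasACDeriv h r) (hr : SqInt r) : ∃ C, ∀ x ∈ I, ‖h x‖ ≤ C :=
  let ⟨_, _, _, _, _, h⟩ := H.exists_limits hr.integrableOn
  h

lemma sqInt (H : HasACDeriv h r) (hr : SqInt r) : SqInt h :=
  let ⟨_, hC⟩ := H.exists_bound hr
  sqInt_of_bdd H.continuousOn hC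

lemma integral_eq_zero (H : HasACDeriv h r) (hr : IntegrableOn r I) (h0 : VanishesAtEnds h) :
    ∫ x in I, r x = 0 := by
  obtain ⟨A, B, hB, hA, e, -⟩ := H.exists_limits hr
  rw [e, tendsto_nhds_unique hB h0.1, tendsto_nhds_unique hA h0.2, sub_zero]

end HasACDeriv

/-! ### Vanishing at the ends forced by integrability. -/

lemma not_integrableOn_inv_sub {c d e : ℝ} (hcd : c < d) (he : e ∈ Icc c d) :
    ¬ IntegrableOn (fun x : ℝ => (x - e)⁻¹) (Ioo c d) := by
  intro hi
  have := (intervalIntegrable_iff_integrableOn_Ioo_of_le hcd.le).2 hi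
  rw [intervalIntegrable_sub_inv_iff, uIcc_of_le hcd.le] at this
  exact this.elim hcd.ne fun h => h he

/-- Near an end e one has 1 - x² ≤ 2|x - e|, so a function bounded away from 0 there would make 1/|x
- e| integrable. -/
lemma not_integrableOn_div_weight {h : ℝ → ℂ} {c d e m : ℝ} (hcd : c < d) (hsub : Ioo c d ⊆ I)
    (he : e ∈ Icc c d) (hm : 0 < m) (he' : e = 1 ∨ e = -1) (hh : ∀ x ∈ Ioo c d, m ≤ ‖h x‖)
    (hi : IntegrableOn (fun x => h x / (1 - (x : ℂ) ^ 2)) I) : False := by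
  refine not_integrableOn_inv_sub hcd he ?_
  refine ((hi.mono_set hsub).norm.const_mul (2 / m)).mono' ?_ ?_
  · exact (measurable_id.sub_const e).inv.aestronglyMeasurable
  · filter_upwards [ae_restrict_mem measurableSet_Ioo] with x hx
    have hxI := hsub hx
    rw [norm_div, norm_weight hxI, norm_inv, Real.norm_eq_abs]
    have hp := weight_pos hxI
    have h2 : 1 - x ^ 2 ≤ 2 * |x - e| ∧ 0 < |x - e| := by
      rcases he' with rfl | rfl
      · rw [abs_of_neg (by linarith [hxI.2])]
        constructor <;> nlinarith [hxI.1, hxI.2]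
      · rw [abs_of_pos (by linarith [hxI.1])]
        constructor <;> nlinarith [hxI.1, hxI.2]
    have h3 := hh x hx
    have h4 : |x - e|⁻¹ ≤ 2 / (1 - x ^ 2) := by
      rw [inv_eq_one_div, div_le_div_iff₀ h2.2 hp]
      linarith [h2.1]
    calc |x - e|⁻¹ ≤ 2 / (1 - x ^ 2) := h4
      _ = 2 / m * (m / (1 - x ^ 2)) := by field_simp
      _ ≤ 2 / m * (‖h x‖ / (1 - x ^ 2)) := by gcongr

/-- The end limits exist because r is integrable; a nonzero limit would make the quotient by 1 - x²
diverge logarithmically at that end. -/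
lemma HasACDeriv.vanishesAtEnds {h r : ℝ → ℂ} (H : HasACDeriv h r) (hr : SqInt r)
    (hh : SqInt (fun x => h x / (1 - (x : ℂ) ^ 2))) : VanishesAtEnds h := by
  obtain ⟨A, B, hB, hA, -, -⟩ := H.exists_limits hr.integrableOn
  constructor
  · by_cases h0 : B = 0
    · rwa [h0] at hB
    exfalso
    have hpos : 0 < ‖B‖ := norm_pos_iff.2 h0
    have hev : ∀ᶠ x in 𝓝[<] (1 : ℝ), x ∈ I ∧ ‖B‖ / 2 ≤ ‖h x‖ :=
      (eventually_of_mem left_mem fun x hx => hx).and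
        (hB.norm.eventually (le_mem_nhds (by linarith)))
    obtain ⟨c, hc, hs⟩ := (mem_nhdsLT_iff_exists_Ioo_subset' (show (0 : ℝ) < 1 by norm_num)).1 hev
    exact not_integrableOn_div_weight hc (fun x hx => (hs hx).1) ⟨le_of_lt hc, le_rfl⟩
      (half_pos hpos) (Or.inl rfl) (fun x hx => (hs hx).2) hh.integrableOn
  · by_cases h0 : A = 0
    · rwa [h0] at hA
    exfalso
    have hpos : 0 < ‖A‖ := norm_pos_iff.2 h0
    have hev : ∀ᶠ x in 𝓝[>] (-1 : ℝ), x ∈ I ∧ ‖A‖ / 2 ≤ ‖h x‖ :=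
      (eventually_of_mem right_mem fun x hx => hx).and
        (hA.norm.eventually (le_mem_nhds (by linarith)))
    obtain ⟨c, hc, hs⟩ := (mem_nhdsGT_iff_exists_Ioo_subset' (show (-1 : ℝ) < 0 by norm_num)).1 hev
    exact not_integrableOn_div_weight hc (fun x hx => (hs hx).1) ⟨le_rfl, le_of_lt hc⟩
      (half_pos hpos) (Or.inr rfl) (fun x hx => (hs hx).2) hh.integrableOn

/-- The weighted energy estimate behind the Hardy inequalities. -/
lemma HasACDeriv.energy {h r : ℝ → ℂ} (H : HasACDeriv h r) {w w' q s : ℝ → ℝ} {C a b : ℝ}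
    (ha : a ∈ I) (hb : b ∈ I) (hab : a ≤ b) (hw : ∀ x ∈ I, HasDerivAt w (w' x) x)
    (hw' : ContinuousOn w' I) (hq : ContinuousOn q I)
    (hs : IntervalIntegrable (fun x => (s x * ‖r x‖) ^ 2) volume a b)
    (h1 : ∀ x ∈ Icc a b, q x ^ 2 ≤ w' x) (h2 : ∀ x ∈ Icc a b, |w x| ≤ C * (q x * s x)) :
    ∫ x in a..b, (q x * ‖h x‖) ^ 2 ≤ 2 * (w b * ‖h b‖ ^ 2 - w a * ‖h a‖ ^ 2)
      + 4 * C ^ 2 * ∫ x in a..b, (s x * ‖r x‖) ^ 2 := by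
  have hsub : Icc a b ⊆ I := Icc_subset_I ha.1 hb.2
  have W : HasACDeriv (fun x => (w x : ℂ)) (fun x => (w' x : ℂ)) :=
    HasACDeriv.of_hasDerivAt (fun x hx => (hw x hx).ofReal_comp)
      (Complex.continuous_ofReal.comp_continuousOn hw')
  -- The estimate integrates (w‖h‖²)' = w'‖h‖² + 2w Re(r h̄).
  have K := W.mul (H.mul H.conj)
  set ρ : ℝ → ℂ := fun x => (w' x : ℂ) * (h x * star (h x))
    + (w x : ℂ) * (r x * star (h x) + h x * star (r x)) with hρ
  have hsq : ∀ z : ℂ, (z * star z) = ((‖z‖ ^ 2 : ℝ) : ℂ) := fun z => by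
    rw [Complex.star_def, Complex.mul_conj, Complex.normSq_eq_norm_sq]
  have e := K.integral_eq_sub ha hb
  have ei := K.intervalIntegrable ha hb
  have eR : ∫ x in a..b, (ρ x).re = w b * ‖h b‖ ^ 2 - w a * ‖h a‖ ^ 2 := by
    have := Complex.reCLM.intervalIntegral_comp_comm ei
    simp only [Complex.reCLM_apply] at this
    rw [this, e, hsq, hsq, ← Complex.ofReal_mul, ← Complex.ofReal_mul, ← Complex.ofReal_sub,
      Complex.ofReal_re]
  have hqi : IntervalIntegrable (fun x => (q x * ‖h x‖) ^ 2) volume a b := by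
    refine ContinuousOn.intervalIntegrable ?_
    rw [uIcc_of_le hab]
    exact ((hq.mul H.continuousOn.norm).pow 2).mono hsub
  have hpt : ∀ x ∈ Icc a b,
      1 / 2 * (q x * ‖h x‖) ^ 2 - 2 * C ^ 2 * (s x * ‖r x‖) ^ 2 ≤ (ρ x).re := by
    intro x hx
    have e1 : (ρ x).re = w' x * ‖h x‖ ^ 2 + w x * (2 * (r x * star (h x)).re) := by
      simp only [hρ]
      rw [hsq, Complex.add_re, ← Complex.ofReal_mul, Complex.ofReal_re, Complex.re_ofReal_mul]
      congr 2
      simp [Complex.mul_re]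
      ring
    have e2 : |(r x * star (h x)).re| ≤ ‖r x‖ * ‖h x‖ := by
      refine (Complex.abs_re_le_norm _).trans ?_
      rw [norm_mul, norm_star]
    have e3 : |w x * (2 * (r x * star (h x)).re)| ≤ C * (q x * s x) * (2 * (‖r x‖ * ‖h x‖)) := by
      rw [abs_mul, abs_mul, abs_two]
      exact mul_le_mul (h2 x hx) (by linarith) (by positivity) ((abs_nonneg _).trans (h2 x hx))
    have e4 := (abs_le.1 e3).1
    have e5 := mul_le_mul_of_nonneg_right (h1 x hx) (sq_nonneg ‖h x‖)
    rw [e1]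
    -- The cross term is absorbed by 2C(q‖h‖)(s‖r‖) ≤ ½(q‖h‖)² + 2C²(s‖r‖)², leaving half of w'‖h‖².
    nlinarith [sq_nonneg (q x * ‖h x‖ - 2 * C * (s x * ‖r x‖))]
  have hmono := intervalIntegral.integral_mono_on hab
    ((hqi.const_mul (1 / 2)).sub (hs.const_mul (2 * C ^ 2))) ⟨ei.1.re, ei.2.re⟩ hpt
  rw [intervalIntegral.integral_sub (hqi.const_mul _) (hs.const_mul _),
    intervalIntegral.integral_const_mul, intervalIntegral.integral_const_mul] at hmono
  change _ ≤ ∫ x in a..b, (ρ x).re at hmono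
  rw [eR] at hmono
  linarith

lemma SqInt.intervalIntegrable_sq {f : ℝ → ℂ} {g : ℝ → ℝ} (hf : SqInt f) {a b : ℝ} (hab : a ≤ b)
    (ha : a ∈ I) (hb : b ∈ I) (hg : ∀ x ∈ I, g x = ‖f x‖) :
    IntervalIntegrable (fun x => g x ^ 2) volume a b := by
  refine IntegrableOn.intervalIntegrable_I ?_ hab ha hb
  refine hf.integrableOn_sq.congr_fun (fun x hx => ?_) measurableSet_Ioo
  simp only [hg x hx]

lemma SqInt.interval_le' {f : ℝ → ℂ} {g : ℝ → ℝ} (hf : SqInt f) {a b : ℝ} (hab : a ≤ b)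
    (ha : a ∈ I) (hb : b ∈ I) (hg : ∀ x ∈ I, g x = ‖f x‖) :
    ∫ x in a..b, g x ^ 2 ≤ ∫ x in I, ‖f x‖ ^ 2 := by
  refine le_of_eq_of_le (intervalIntegral.integral_congr fun x hx => ?_) (hf.interval_le hab ha hb)
  rw [uIcc_of_le hab] at hx
  simp only [hg x (Icc_subset_I ha.1 hb.2 hx)]

lemma norm_weight_pow_mul (k : ℕ) {x : ℝ} (hx : x ∈ I) (z : ℂ) :
    ‖(1 - (x : ℂ) ^ 2) ^ k * z‖ = (1 - x ^ 2) ^ k * ‖z‖ := by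
  rw [norm_mul, norm_pow, norm_weight hx]

lemma hasDerivAt_weight (x : ℝ) : HasDerivAt (fun x : ℝ => 1 - x ^ 2) (-(2 * x)) x := by
  have := ((hasDerivAt_id x).pow 2).const_sub 1
  simpa using this

/-! ### The two Hardy inequalities. -/

namespace HasACDeriv

variable {h r : ℝ → ℂ}

lemma norm_sub_sq_le {k : ℕ} (H : HasACDeriv h (fun x => (1 - (x : ℂ) ^ 2) ^ k * r x))
    (hr : SqInt r) {a b P : ℝ} (hab : a < b) (ha : a ∈ I) (hb : b ∈ I)
    (hP : ∀ x ∈ Icc a b, 1 - x ^ 2 ≤ P) :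
    ‖h b - h a‖ ^ 2 ≤ P ^ (2 * k) * (b - a) * ∫ x in I, ‖r x‖ ^ 2 := by
  have hsub := Icc_subset_I ha.1 hb.2
  have hP0 : 0 ≤ P := (weight_pos ha).le.trans (hP a ⟨le_rfl, hab.le⟩)
  have hri : IntervalIntegrable r volume a b := by
    rw [intervalIntegrable_iff, uIoc_of_le hab.le]
    exact hr.integrableOn.mono_set (Ioc_subset_I ha.1.le hb.2)
  have h1 : ‖h b - h a‖ ≤ P ^ k * ∫ x in a..b, ‖r x‖ := by
    rw [← H.integral_eq_sub ha hb, ← intervalIntegral.integral_const_mul]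
    refine (intervalIntegral.norm_integral_le_integral_norm hab.le).trans
      (intervalIntegral.integral_mono_on hab.le (H.intervalIntegrable ha hb).norm
        (hri.norm.const_mul _) fun x hx => ?_)
    rw [norm_weight_pow_mul k (hsub hx)]
    exact mul_le_mul_of_nonneg_right (pow_le_pow_left₀ (weight_pos (hsub hx)).le (hP x hx) k)
      (norm_nonneg _)
  have h2 := sq_integral_norm_le hab hri
    (hr.intervalIntegrable_sq hab.le ha hb fun _ _ => rfl)
  have h3 := hr.interval_le hab.le ha hb
  calc ‖h b - h a‖ ^ 2 ≤ (P ^ k * ∫ x in a..b, ‖r x‖) ^ 2 := by gcongr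
    _ = P ^ (2 * k) * (∫ x in a..b, ‖r x‖) ^ 2 := by ring
    _ ≤ P ^ (2 * k) * ((b - a) * ∫ x in a..b, ‖r x‖ ^ 2) := by gcongr
    _ ≤ P ^ (2 * k) * ((b - a) * ∫ x in I, ‖r x‖ ^ 2) := by
        have := sub_nonneg.2 hab.le
        gcongr
    _ = _ := by ring

/-- Let the far point c tend to 1, where h vanishes. For b ≥ 0 both the weight on [b,c] and the
length c - b are at most 1 - b², which accounts for the exponent 2k + 1. This is the size needed to
control the boundary terms in `hardy_outer`. -/
lemma norm_sq_le_right {k : ℕ} (H : HasACDeriv h (fun x => (1 - (x : ℂ) ^ 2) ^ k * r x))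
    (hr : SqInt r) (h0 : VanishesAtEnds h) {b : ℝ} (hb0 : 0 ≤ b) (hb1 : b < 1) :
    ‖h b‖ ^ 2 ≤ (1 - b ^ 2) ^ (2 * k + 1) * ∫ x in I, ‖r x‖ ^ 2 := by
  have hb : b ∈ I := ⟨by linarith, hb1⟩
  have hM : 0 ≤ ∫ x in I, ‖r x‖ ^ 2 := integral_nonneg fun x => by positivity
  have ht : Tendsto (fun c => ‖h c - h b‖ ^ 2) (𝓝[<] 1) (𝓝 (‖0 - h b‖ ^ 2)) :=
    ((h0.1.sub_const (h b)).norm).pow 2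
  rw [zero_sub, norm_neg] at ht
  refine le_of_tendsto ht ?_
  filter_upwards [Ioo_mem_nhdsLT hb1] with c hc
  have hp := weight_pos hb
  refine (H.norm_sub_sq_le hr hc.1 hb ⟨by linarith [hc.1], hc.2⟩ (P := 1 - b ^ 2)
    fun x hx => by nlinarith [hx.1]).trans ?_
  rw [pow_succ]
  refine mul_le_mul_of_nonneg_right (mul_le_mul_of_nonneg_left ?_ (by positivity)) hM
  nlinarith [hc.2]

lemma norm_sq_le_left {k : ℕ} (H : HasACDeriv h (fun x => (1 - (x : ℂ) ^ 2) ^ k * r x))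
    (hr : SqInt r) (h0 : VanishesAtEnds h) {b : ℝ} (hb0 : b ≤ 0) (hb1 : -1 < b) :
    ‖h b‖ ^ 2 ≤ (1 - b ^ 2) ^ (2 * k + 1) * ∫ x in I, ‖r x‖ ^ 2 := by
  have hb : b ∈ I := ⟨hb1, by linarith⟩
  have hM : 0 ≤ ∫ x in I, ‖r x‖ ^ 2 := integral_nonneg fun x => by positivity
  have ht : Tendsto (fun c => ‖h b - h c‖ ^ 2) (𝓝[>] (-1)) (𝓝 (‖h b - 0‖ ^ 2)) :=
    ((h0.2.const_sub (h b)).norm).pow 2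
  rw [sub_zero] at ht
  refine le_of_tendsto ht ?_
  filter_upwards [Ioo_mem_nhdsGT hb1] with c hc
  have hp := weight_pos hb
  refine (H.norm_sub_sq_le hr hc.2 ⟨hc.1, by linarith [hc.2]⟩ hb (P := 1 - b ^ 2)
    fun x hx => by nlinarith [hx.2]).trans ?_
  rw [pow_succ]
  refine mul_le_mul_of_nonneg_right (mul_le_mul_of_nonneg_left ?_ (by positivity)) hM
  nlinarith [hc.1]

/-- A Hardy inequality for functions that vanish at the ends. -/
lemma hardy_outer (k : ℕ) (H : HasACDeriv h (fun x => (1 - (x : ℂ) ^ 2) ^ k * r x))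
    (h0 : VanishesAtEnds h) (hr : SqInt r) :
    SqInt (fun x => h x / (1 - (x : ℂ) ^ 2) ^ (k + 1)) := by
  set M := ∫ x in I, ‖r x‖ ^ 2 with hM
  have hM0 : 0 ≤ M := integral_nonneg fun x => by positivity
  have hpc : Continuous fun x : ℝ => 1 - x ^ 2 := by fun_prop
  have hpi : ∀ n : ℕ, ContinuousOn (fun x : ℝ => ((1 - x ^ 2) ^ n)⁻¹) I := fun n =>
    (hpc.pow n).continuousOn.inv₀ fun x hx => (pow_pos (weight_pos hx) n).ne'
  refine sqInt_of_interval_le (B := 2 * (M + M) + 4 * 1 ^ 2 * M) ?_ fun b hb0 hb1 => ?_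
  · refine H.continuousOn.div (by fun_prop) fun x hx => pow_ne_zero _ (weight_ne hx)
  have hbI : b ∈ I := ⟨by linarith, hb1⟩
  have hbI' : -b ∈ I := ⟨by linarith, by linarith⟩
  have hs : ∀ x ∈ I, ((1 - x ^ 2) ^ k)⁻¹ * ‖(1 - (x : ℂ) ^ 2) ^ k * r x‖ = ‖r x‖ := fun x hx => by
    rw [norm_weight_pow_mul k hx]
    have := (pow_pos (weight_pos hx) k).ne'
    field_simp
  -- The weight w = x p^(-(2k+1)) with p = 1 - x² has w' = (1 + (4k+1)x²) p^(-(2k+2)), which is at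
  -- least q². Its boundary terms at ±b are each at most M by the two pointwise bounds above.
  have key := H.energy (w := fun x => x * ((1 - x ^ 2) ^ (2 * k + 1))⁻¹)
    (w' := fun x => ((1 - x ^ 2) ^ (2 * k + 1))⁻¹
      + (2 * (2 * k + 1)) * x ^ 2 * ((1 - x ^ 2) ^ (2 * k + 2))⁻¹)
    (q := fun x => ((1 - x ^ 2) ^ (k + 1))⁻¹) (s := fun x => ((1 - x ^ 2) ^ k)⁻¹) (C := 1)
    hbI' hbI (by linarith) ?_ ?_ (hpi _)
    (hr.intervalIntegrable_sq (by linarith) hbI' hbI hs) ?_ ?_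
  · have e : ∫ x in (-b)..b, ‖h x / (1 - (x : ℂ) ^ 2) ^ (k + 1)‖ ^ 2
        = ∫ x in (-b)..b, (((1 - x ^ 2) ^ (k + 1))⁻¹ * ‖h x‖) ^ 2 := by
      refine intervalIntegral.integral_congr fun x hx => ?_
      rw [uIcc_of_le (by linarith)] at hx
      rw [norm_div, norm_pow, norm_weight (Icc_subset_I hbI'.1 hbI.2 hx), div_eq_inv_mul]
    rw [e]
    refine key.trans ?_
    have hp := pow_pos (weight_pos hbI) (2 * k + 1)
    have b1 : b * ((1 - b ^ 2) ^ (2 * k + 1))⁻¹ * ‖h b‖ ^ 2 ≤ M := by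
      have := H.norm_sq_le_right hr h0 hb0 hb1
      rw [mul_assoc, inv_mul_eq_div]
      have h3 : ‖h b‖ ^ 2 / (1 - b ^ 2) ^ (2 * k + 1) ≤ M := by
        rw [div_le_iff₀ hp]
        linarith
      have h4 : 0 ≤ ‖h b‖ ^ 2 / (1 - b ^ 2) ^ (2 * k + 1) := by positivity
      nlinarith
    have b2 : b * ((1 - b ^ 2) ^ (2 * k + 1))⁻¹ * ‖h (-b)‖ ^ 2 ≤ M := by
      have := H.norm_sq_le_left hr h0 (b := -b) (by linarith) (by linarith)
      rw [neg_sq] at this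
      rw [mul_assoc, inv_mul_eq_div]
      have h3 : ‖h (-b)‖ ^ 2 / (1 - b ^ 2) ^ (2 * k + 1) ≤ M := by
        rw [div_le_iff₀ hp]
        linarith
      have h4 : 0 ≤ ‖h (-b)‖ ^ 2 / (1 - b ^ 2) ^ (2 * k + 1) := by positivity
      nlinarith
    have b3 := hr.interval_le' (by linarith) hbI' hbI hs
    rw [neg_sq]
    linarith
  · intro x hx
    have hx0 := (weight_pos hx).ne'
    have := (hasDerivAt_id x).mul (((hasDerivAt_weight x).pow (2 * k + 1)).inv
      (pow_ne_zero _ hx0))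
    refine this.congr_deriv ?_
    simp only [id, Pi.pow_apply, Nat.add_sub_cancel, Pi.inv_apply]
    push_cast
    field_simp
    ring
  · exact (hpi _).add ((by fun_prop : Continuous fun x : ℝ =>
      (2 * (2 * (k : ℝ) + 1)) * x ^ 2).continuousOn.mul (hpi _))
  · intro x hx
    have hxI := Icc_subset_I hbI'.1 hbI.2 hx
    have hp := weight_pos hxI
    have : ((1 - x ^ 2) ^ (2 * k + 1))⁻¹ + (2 * (2 * k + 1)) * x ^ 2 * ((1 - x ^ 2) ^ (2 * k + 2))⁻¹
        = ((1 - x ^ 2) + (2 * (2 * k + 1)) * x ^ 2) * (((1 - x ^ 2) ^ (k + 1))⁻¹) ^ 2 := by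
      field_simp
      ring
    rw [this]
    have hk : (0 : ℝ) ≤ k := k.cast_nonneg
    refine le_mul_of_one_le_left (by positivity) ?_
    nlinarith [mul_nonneg hk (sq_nonneg x), sq_nonneg x]
  · intro x hx
    have hxI := Icc_subset_I hbI'.1 hbI.2 hx
    have hp := weight_pos hxI
    rw [abs_mul, abs_of_pos (show 0 < ((1 - x ^ 2) ^ (2 * k + 1))⁻¹ by positivity), one_mul,
      ← mul_inv, ← pow_add, show k + 1 + k = 2 * k + 1 by ring]
    refine mul_le_of_le_one_left (by positivity) (abs_le.2 ⟨hxI.1.le, hxI.2.le⟩)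

/-- A Hardy inequality for weights that vanish at the ends. -/
lemma hardy_inner (k : ℕ) (H : HasACDeriv h r)
    (hr : SqInt (fun x => (1 - (x : ℂ) ^ 2) ^ (k + 1) * r x)) :
    SqInt (fun x => (1 - (x : ℂ) ^ 2) ^ k * h x) := by
  set M := ∫ x in I, ‖(1 - (x : ℂ) ^ 2) ^ (k + 1) * r x‖ ^ 2 with hM
  have hM0 : 0 ≤ M := integral_nonneg fun x => by positivity
  have hc : ContinuousOn (fun x : ℝ => (1 - (x : ℂ) ^ 2) ^ k * h x) I :=
    (by fun_prop : Continuous fun x : ℝ => (1 - (x : ℂ) ^ 2) ^ k).continuousOn.mul H.continuousOn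
  have hs : ∀ x ∈ I, (1 - x ^ 2) ^ (k + 1) * ‖r x‖ = ‖(1 - (x : ℂ) ^ 2) ^ (k + 1) * r x‖ :=
    fun x hx => (norm_weight_pow_mul _ hx _).symm
  set B := (2 ^ k) ^ 2 * (2 * ‖h 0‖ ^ 2 + 4 * 1 ^ 2 * M) with hB
  have hk : (0 : ℝ) ≤ k := k.cast_nonneg
  -- On each half of the interval, p = 1 - x² may be replaced by the distance q to the nearer end,
  -- since p ≤ 2q; the factor (2^k)² in B comes from here.
  have comp : ∀ {a b : ℝ} {q : ℝ → ℝ}, a ∈ I → b ∈ I → a ≤ b → Continuous q →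
      (∀ x ∈ Icc a b, 0 ≤ q x ∧ 1 - x ^ 2 ≤ 2 * q x) →
      (∫ x in a..b, (q x ^ k * ‖h x‖) ^ 2) ≤ 2 * ‖h 0‖ ^ 2 + 4 * 1 ^ 2 * M →
      ∫ x in a..b, ‖(1 - (x : ℂ) ^ 2) ^ k * h x‖ ^ 2 ≤ B := by
    intro a b q ha hb hab hq hle hbd
    have hsub := Icc_subset_I ha.1 hb.2
    refine le_trans ?_ (mul_le_mul_of_nonneg_left hbd (by positivity))
    rw [← intervalIntegral.integral_const_mul]
    refine intervalIntegral.integral_mono_on hab ?_ ?_ fun x hx => ?_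
    · refine ContinuousOn.intervalIntegrable ?_
      rw [uIcc_of_le hab]
      exact (hc.mono hsub).norm.pow 2
    · refine ContinuousOn.intervalIntegrable ?_
      rw [uIcc_of_le hab]
      exact continuousOn_const.mul
        (((hq.pow k).continuousOn.mul (H.continuousOn.mono hsub).norm).pow 2)
    · rw [norm_weight_pow_mul k (hsub hx), ← mul_pow, ← mul_assoc, ← mul_pow]
      obtain ⟨_, h2⟩ := hle x hx
      have := (weight_pos (hsub hx)).le
      gcongr
  refine sqInt_of_interval_le (B := B + B) hc fun b hb0 hb1 => ?_
  have hbI : b ∈ I := ⟨by linarith, hb1⟩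
  have hbI' : -b ∈ I := ⟨by linarith, by linarith⟩
  have hint : ∀ {a c : ℝ}, a ∈ I → c ∈ I → a ≤ c → IntervalIntegrable
      (fun x => ‖(1 - (x : ℂ) ^ 2) ^ k * h x‖ ^ 2) volume a c := fun ha hc' hac => by
    refine ContinuousOn.intervalIntegrable ?_
    rw [uIcc_of_le hac]
    exact (hc.mono (Icc_subset_I ha.1 hc'.2)).norm.pow 2
  rw [← intervalIntegral.integral_add_adjacent_intervals
    (hint hbI' zero_mem_I (by linarith)) (hint zero_mem_I hbI hb0)]
  refine add_le_add ?_ ?_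
  · refine comp hbI' zero_mem_I (by linarith) (q := fun x => 1 + x) (by fun_prop)
      (fun x hx => ⟨by linarith [hx.1], by nlinarith [hx.1, hx.2]⟩) ?_
    -- The boundary term of w = (1+x)^(2k+1) at -b has the favourable sign and is dropped; the one
    -- at 0 leaves ‖h 0‖². No end condition on h is required.
    have key := H.energy (w := fun x => (1 + x) ^ (2 * k + 1))
      (w' := fun x => (2 * k + 1) * (1 + x) ^ (2 * k)) (q := fun x => (1 + x) ^ k)
      (s := fun x => (1 - x ^ 2) ^ (k + 1)) (C := 1) hbI' zero_mem_I (by linarith) ?_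
      (by fun_prop) (by fun_prop) (hr.intervalIntegrable_sq (by linarith) hbI' zero_mem_I hs) ?_ ?_
    · have b3 := hr.interval_le' (by linarith) hbI' zero_mem_I hs
      have b4 : 0 ≤ (1 + -b) ^ (2 * k + 1) * ‖h (-b)‖ ^ 2 := by
        have : 0 ≤ 1 + -b := by linarith
        positivity
      simp only [add_zero, one_pow, one_mul] at key ⊢
      linarith
    · intro x _
      have := ((hasDerivAt_id x).const_add 1).pow (2 * k + 1)
      refine this.congr_deriv ?_
      simp only [id, Nat.add_sub_cancel]
      push_cast
      ring
    · intro x hx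
      rw [← pow_mul, mul_comm k 2]
      have : 0 ≤ 1 + x := by linarith [hx.1]
      exact le_mul_of_one_le_left (by positivity) (by linarith)
    · intro x hx
      have h1 : 0 ≤ 1 + x := by linarith [hx.1]
      have h2 : 1 + x ≤ 1 - x ^ 2 := by nlinarith [hx.1, hx.2]
      rw [abs_of_nonneg (by positivity), one_mul, show 2 * k + 1 = k + (k + 1) by ring, pow_add]
      gcongr
  · refine comp zero_mem_I hbI hb0 (q := fun x => 1 - x) (by fun_prop)
      (fun x hx => ⟨by linarith [hx.2], by nlinarith [hx.1, hx.2]⟩) ?_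
    -- The sign of w is reversed so that w is again increasing and the term at b can be dropped.
    have key := H.energy (w := fun x => -(1 - x) ^ (2 * k + 1))
      (w' := fun x => (2 * k + 1) * (1 - x) ^ (2 * k)) (q := fun x => (1 - x) ^ k)
      (s := fun x => (1 - x ^ 2) ^ (k + 1)) (C := 1) zero_mem_I hbI hb0 ?_
      (by fun_prop) (by fun_prop) (hr.intervalIntegrable_sq hb0 zero_mem_I hbI hs) ?_ ?_
    · have b3 := hr.interval_le' hb0 zero_mem_I hbI hs
      have b4 : 0 ≤ (1 - b) ^ (2 * k + 1) * ‖h b‖ ^ 2 := by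
        have : 0 ≤ 1 - b := by linarith
        positivity
      simp only [sub_zero, one_pow] at key ⊢
      linarith
    · intro x _
      have := (((hasDerivAt_id x).const_sub 1).pow (2 * k + 1)).neg
      refine this.congr_deriv ?_
      simp only [id, Nat.add_sub_cancel]
      push_cast
      ring
    · intro x hx
      rw [← pow_mul, mul_comm k 2]
      have : 0 ≤ 1 - x := by linarith [hx.2]
      exact le_mul_of_one_le_left (by positivity) (by linarith)
    · intro x hx
      have h1 : 0 ≤ 1 - x := by linarith [hx.2]
      have h2 : 1 - x ≤ 1 - x ^ 2 := by nlinarith [hx.1, hx.2]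
      rw [abs_neg, abs_of_nonneg (by positivity), one_mul,
        show 2 * k + 1 = k + (k + 1) by ring, pow_add]
      gcongr

end HasACDeriv

/-! ### Functions vanishing at the ends -/

namespace VanishesAtEnds

variable {g h : ℝ → ℂ}

lemma congr_on (hg : VanishesAtEnds g) (e : EqOn g h I) : VanishesAtEnds h :=
  ⟨hg.1.congr' (e.eventuallyEq_of_mem left_mem), hg.2.congr' (e.eventuallyEq_of_mem right_mem)⟩

lemma add (hg : VanishesAtEnds g) (hh : VanishesAtEnds h) :
    VanishesAtEnds (fun x => g x + h x) :=
  ⟨by simpa using hg.1.add hh.1, by simpa using hg.2.add hh.2⟩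

lemma sub (hg : VanishesAtEnds g) (hh : VanishesAtEnds h) :
    VanishesAtEnds (fun x => g x - h x) :=
  ⟨by simpa using hg.1.sub hh.1, by simpa using hg.2.sub hh.2⟩

lemma bdd_mul {C : ℝ} (hg : VanishesAtEnds g) (hh : ∀ x ∈ I, ‖h x‖ ≤ C) :
    VanishesAtEnds (fun x => h x * g x) := by
  have key : ∀ l : Filter ℝ, I ∈ l → Tendsto g l (𝓝 0) → Tendsto (fun x => h x * g x) l (𝓝 0) := by
    intro l hl hg
    refine squeeze_zero_norm' (a := fun x => C * ‖g x‖) ?_ (by simpa using hg.norm.const_mul C)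
    filter_upwards [hl] with x hx
    rw [norm_mul]
    exact mul_le_mul_of_nonneg_right (hh x hx) (norm_nonneg _)
  exact ⟨key _ left_mem hg.1, key _ right_mem hg.2⟩

lemma continuous_mul (hg : VanishesAtEnds g) (hh : Continuous h) :
    VanishesAtEnds (fun x => h x * g x) := by
  obtain ⟨M, hM⟩ := (isCompact_Icc (a := (-1 : ℝ)) (b := 1)).exists_bound_of_continuousOn
    hh.continuousOn
  exact hg.bdd_mul fun x hx => hM x (Ioo_subset_Icc_self hx)

end VanishesAtEnds

lemma vanishesAtEnds_weight : VanishesAtEnds (fun x : ℝ => 1 - (x : ℂ) ^ 2) := by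
  have hc : Continuous fun x : ℝ => 1 - (x : ℂ) ^ 2 := by fun_prop
  refine ⟨?_, ?_⟩
  · have := (hc.tendsto 1).mono_left (nhdsWithin_le_nhds (s := Iio 1))
    simpa using this
  · have := (hc.tendsto (-1)).mono_left (nhdsWithin_le_nhds (s := Ioi (-1)))
    simpa using this

lemma hasDerivAt_ofReal (x : ℝ) : HasDerivAt (fun t : ℝ => (t : ℂ)) 1 x :=
  Complex.ofRealCLM.hasDerivAt

lemma hasACDeriv_id : HasACDeriv (fun x : ℝ => (x : ℂ)) (fun _ => 1) :=
  HasACDeriv.of_hasDerivAt (fun x _ => hasDerivAt_ofReal x) continuousOn_const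

lemma hasDerivAt_cweight (x : ℝ) :
    HasDerivAt (fun x : ℝ => 1 - (x : ℂ) ^ 2) (-(2 * (x : ℂ))) x := by
  have := ((hasDerivAt_ofReal x).pow 2).const_sub 1
  simpa using this

lemma hasACDeriv_weight : HasACDeriv (fun x : ℝ => 1 - (x : ℂ) ^ 2) (fun x => -(2 * (x : ℂ))) :=
  HasACDeriv.of_hasDerivAt (fun x _ => hasDerivAt_cweight x) (by fun_prop)

lemma hasACDeriv_weight_inv : HasACDeriv (fun x : ℝ => (1 - (x : ℂ) ^ 2)⁻¹)
    (fun x => 2 * (x : ℂ) / (1 - (x : ℂ) ^ 2) ^ 2) := by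
  refine HasACDeriv.of_hasDerivAt (fun x hx => ?_) ?_
  · have := (hasDerivAt_cweight x).inv (weight_ne hx)
    rwa [neg_neg] at this
  · exact ContinuousOn.div (by fun_prop) (by fun_prop) fun x hx => pow_ne_zero _ (weight_ne hx)

/-! ### Iterated derivatives -/

lemma ACLocUpTo.chain {f : ℝ → ℂ} (h : ACLocUpTo 3 f) :
    HasACDeriv f (deriv f) ∧ HasACDeriv (deriv f) (iteratedDeriv 2 f) ∧
      HasACDeriv (iteratedDeriv 2 f) (iteratedDeriv 3 f) ∧
      HasACDeriv (iteratedDeriv 3 f) (iteratedDeriv 4 f) := by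
  have h0 := (h.2 0 (by norm_num)).hasACDeriv
  have h1 := (h.2 1 (by norm_num)).hasACDeriv
  have h2 := (h.2 2 (by norm_num)).hasACDeriv
  have h3 := (h.2 3 (by norm_num)).hasACDeriv
  rw [← iteratedDeriv_succ] at h1 h2 h3
  rw [iteratedDeriv_zero] at h0
  rw [iteratedDeriv_one] at h1
  exact ⟨h0, h1, h2, h3⟩

lemma HasACDeriv.deriv_eqOn {h r : ℝ → ℂ} (H : HasACDeriv h r) (hr : ContinuousOn r I) :
    EqOn (deriv h) r I := fun _ hx => (H.hasDerivAt hr hx).deriv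

lemma iteratedDeriv_eqOn_of_chain {f f₁ f₂ f₃ : ℝ → ℂ} (h0 : HasACDeriv f f₁)
    (h1 : HasACDeriv f₁ f₂) (h2 : HasACDeriv f₂ f₃) (h3 : ACLoc f₃) :
    EqOn (deriv f) f₁ I ∧ EqOn (iteratedDeriv 2 f) f₂ I ∧ EqOn (iteratedDeriv 3 f) f₃ I := by
  have e1 := h0.deriv_eqOn h1.continuousOn
  have e2 : EqOn (iteratedDeriv 2 f) f₂ I := by
    rw [iteratedDeriv_succ, iteratedDeriv_one]
    exact (LegendreSquare.deriv_eqOn e1).trans (h1.deriv_eqOn h2.continuousOn)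
  refine ⟨e1, e2, ?_⟩
  rw [iteratedDeriv_succ]
  exact (LegendreSquare.deriv_eqOn e2).trans (h2.deriv_eqOn h3.continuousOn)

/-- Each derivative in the chain but the last is continuous, so the almost everywhere relations
upgrade to genuine derivatives on (-1,1); only the fourth remains an almost everywhere statement. -/
lemma acLocUpTo_of_chain {f f₁ f₂ f₃ f₄ : ℝ → ℂ} (h0 : HasACDeriv f f₁)
    (h1 : HasACDeriv f₁ f₂) (h2 : HasACDeriv f₂ f₃) (h3 : HasACDeriv f₃ f₄) :
    ACLocUpTo 3 f ∧ iteratedDeriv 4 f =ᵐ[μI] f₄ := by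
  obtain ⟨e1, e2, e3⟩ := iteratedDeriv_eqOn_of_chain h0 h1 h2 h3.1
  have k1 := h1.congr_left e1.symm
  have k2 := h2.congr_left e2.symm
  have k3 := h3.congr_left e3.symm
  refine ⟨⟨fun k hk => ?_, fun k hk => ?_⟩, ?_⟩
  · interval_cases k
    · rw [iteratedDeriv_zero]
      exact fun x hx => (h0.hasDerivAt h1.continuousOn hx).differentiableAt.differentiableWithinAt
    · rw [iteratedDeriv_one]
      exact fun x hx => (k1.hasDerivAt h2.continuousOn hx).differentiableAt.differentiableWithinAt
    · exact fun x hx => (k2.hasDerivAt h3.continuousOn hx).differentiableAt.differentiableWithinAt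
  · interval_cases k
    · rw [iteratedDeriv_zero]
      exact h0.1
    · rw [iteratedDeriv_one]
      exact k1.1
    · exact k2.1
    · exact k3.1
  · rw [iteratedDeriv_succ]
    exact k3.deriv_ae

/-! ### The domain of the Legendre operator -/

lemma domA_congr {f g : ℝ → ℂ} (hf : f ∈ domA) (h : EqOn f g I) : g ∈ domA := by
  have h' := deriv_eqOn h
  refine ⟨⟨⟨fun k hk => ?_, fun k hk => ?_⟩, hf.1.2.1.congr_on h, hf.1.2.2.congr_on (ell_eqOn h)⟩,
    hf.2.congr_on fun x hx => by simp only [h' hx]⟩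
  · obtain rfl : k = 0 := by omega
    rw [iteratedDeriv_zero]
    exact fun x hx => ((domA_differentiableAt hf hx).differentiableWithinAt).congr
      (fun y hy => (h hy).symm) (h hx).symm
  · interval_cases k
    · rw [iteratedDeriv_zero]
      exact (domA_acLoc hf).congr h
    · rw [iteratedDeriv_one]
      exact (domA_acLoc_deriv hf).congr h'

lemma HasACDeriv.ell_ae {f f₁ g : ℝ → ℂ} (hf : HasACDeriv f f₁) (hc : ContinuousOn f₁ I)
    (hF : HasACDeriv (fun x => (1 - (x : ℂ) ^ 2) * f₁ x) (fun x => -g x)) : ell f =ᵐ[μI] g := by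
  have e := hf.deriv_eqOn hc
  have hF' := hF.congr_left (k := fun x => (1 - (x : ℂ) ^ 2) * deriv f x)
    fun x hx => by simp only [e hx]
  filter_upwards [hF'.deriv_ae] with x hx
  rw [ell, hx, neg_neg]

lemma HasACDeriv.ell_eqOn {f f₁ g : ℝ → ℂ} (hf : HasACDeriv f f₁) (hc : ContinuousOn f₁ I)
    (hF : HasACDeriv (fun x => (1 - (x : ℂ) ^ 2) * f₁ x) (fun x => -g x))
    (hg : ContinuousOn g I) : EqOn (ell f) g I := by
  have e := hf.deriv_eqOn hc
  have hF' := hF.congr_left (k := fun x => (1 - (x : ℂ) ^ 2) * deriv f x)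
    fun x hx => by simp only [e hx]
  intro x hx
  rw [ell, (hF'.hasDerivAt hg.neg hx).deriv, neg_neg]

/-- Dividing by 1 - x², which has no zero inside the interval, recovers the regularity of f₁ from
that of its flux. -/
lemma hasACDeriv_of_weight_mul {f₁ F' : ℝ → ℂ}
    (hF : HasACDeriv (fun x => (1 - (x : ℂ) ^ 2) * f₁ x) F') : HasACDeriv f₁
      (fun x => F' x / (1 - (x : ℂ) ^ 2) + 2 * x * f₁ x / (1 - (x : ℂ) ^ 2)) := by
  refine ((hasACDeriv_weight_inv.mul hF).congr_left fun x hx => ?_).congr_right_on fun x hx => ?_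
  · have := weight_ne hx
    field_simp
  · have := weight_ne hx
    field_simp
    ring

lemma domA_of_flux {f f₁ g : ℝ → ℂ} (hf : HasACDeriv f f₁) (hc : ContinuousOn f₁ I)
    (hF : HasACDeriv (fun x => (1 - (x : ℂ) ^ 2) * f₁ x) (fun x => -g x))
    (h0 : VanishesAtEnds (fun x : ℝ => (1 - (x : ℂ) ^ 2) * f₁ x)) (hfL : SqInt f) (hg : SqInt g) :
    f ∈ domA := by
  have e := hf.deriv_eqOn hc
  refine ⟨⟨⟨fun k hk => ?_, fun k hk => ?_⟩, hfL, hg.congr_ae (hf.ell_ae hc hF).symm⟩,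
    h0.congr_on fun x hx => by simp only [e hx]⟩
  · obtain rfl : k = 0 := by omega
    rw [iteratedDeriv_zero]
    exact fun x hx => (hf.hasDerivAt hc hx).differentiableAt.differentiableWithinAt
  · interval_cases k
    · rw [iteratedDeriv_zero]
      exact hf.1
    · rw [iteratedDeriv_one]
      exact (hasACDeriv_of_weight_mul hF).1.congr e.symm

lemma domA_hasACDeriv {f : ℝ → ℂ} (hf : f ∈ domA) : HasACDeriv f (deriv f) :=
  (domA_acLoc hf).hasACDeriv

lemma domA_hasACDeriv_deriv {f : ℝ → ℂ} (hf : f ∈ domA) :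
    HasACDeriv (deriv f) (deriv (deriv f)) :=
  (domA_acLoc_deriv hf).hasACDeriv

lemma domA_flux {f : ℝ → ℂ} (hf : f ∈ domA) :
    HasACDeriv (fun x => (1 - (x : ℂ) ^ 2) * deriv f x) (fun x => -ell f x) := by
  have := (hasACDeriv_weight.mul (domA_hasACDeriv_deriv hf)).1.hasACDeriv
  exact this.congr_right (Eventually.of_forall fun x => by simp [ell])

/-- A flux vanishing at the ends with square integrable derivative comes from a square integrable
function. -/
lemma sqInt_of_flux {f₁ g : ℝ → ℂ}
    (hF : HasACDeriv (fun x => (1 - (x : ℂ) ^ 2) * f₁ x) (fun x => -g x))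
    (h0 : VanishesAtEnds (fun x : ℝ => (1 - (x : ℂ) ^ 2) * f₁ x)) (hg : SqInt g) : SqInt f₁ := by
  have h1 := HasACDeriv.hardy_outer 0 (r := fun x => -g x) (hF.congr_right_on fun x _ => by simp)
    h0 hg.neg'
  refine h1.congr_on fun x hx => ?_
  have := weight_ne hx
  field_simp
  ring

lemma domA_deriv_sqInt {f : ℝ → ℂ} (hf : f ∈ domA) : SqInt (deriv f) :=
  sqInt_of_flux (domA_flux hf) hf.2 hf.1.2.2

/-- Expanding ℓ gives (1 - x²)f'' = 2x f' - ℓ[f] almost everywhere, and f' is already in L². -/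
lemma domA_weight_deriv2_sqInt {f : ℝ → ℂ} (hf : f ∈ domA) :
    SqInt (fun x => (1 - (x : ℂ) ^ 2) * deriv (deriv f) x) := by
  have h1 := ((domA_flux hf).deriv_ae.symm.trans
    (hasACDeriv_weight.mul (domA_hasACDeriv_deriv hf)).deriv_ae)
  have h2 := (((domA_deriv_sqInt hf).mul_continuous
    (by fun_prop : Continuous fun x : ℝ => 2 * (x : ℂ)))).sub' hf.1.2.2
  refine h2.congr_ae ?_
  filter_upwards [h1] with x hx
  linear_combination hx

/-- Functions in the domain of `A²` have four derivatives with the weighted bounds. -/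
lemma acLocUpTo_of_domASq {f : ℝ → ℂ} (hf : f ∈ domASq) : ACLocUpTo 3 f ∧
    SqInt (fun x : ℝ => (1 - (x : ℂ) ^ 2) ^ 2 * iteratedDeriv 4 f x) := by
  obtain ⟨hf, hg⟩ := hf
  set g := ell f with hgdef
  set f₁ := deriv f with hf₁
  set g₁ := deriv g with hg₁
  set g₂ := deriv g₁ with hg₂
  have G0 := domA_hasACDeriv hg
  have G1 := domA_hasACDeriv_deriv hg
  have H0 := domA_hasACDeriv hf
  -- The equation 2x f' - (1 - x²)f'' = g is solved for f''; differentiating it once and twice gives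
  -- f₃ and f₄.
  set f₂ : ℝ → ℂ := fun x => (2 * x * f₁ x - g x) / (1 - (x : ℂ) ^ 2) with hf₂
  set f₃ : ℝ → ℂ := fun x => (2 * f₁ x + 4 * x * f₂ x - g₁ x) / (1 - (x : ℂ) ^ 2) with hf₃
  set f₄ : ℝ → ℂ := fun x => (6 * f₂ x + 6 * x * f₃ x - g₂ x) / (1 - (x : ℂ) ^ 2) with hf₄
  have H1 : HasACDeriv f₁ f₂ := (hasACDeriv_of_weight_mul (domA_flux hf)).congr_right_on fun x hx => by
    simp only [hf₂, hf₁, hgdef]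
    ring
  have H2 : HasACDeriv f₂ f₃ := by
    refine (hasACDeriv_of_weight_mul (f₁ := f₂) (F' := fun x => 2 * f₁ x + 2 * x * f₂ x - g₁ x)
      ?_).congr_right_on fun x hx => ?_
    · refine ((((hasACDeriv_id.const_mul 2).mul H1).sub G0).congr_left
        fun x hx => ?_).congr_right_on fun x _ => ?_
      · have := weight_ne hx
        simp only [hf₂]
        field_simp
      · ring
    · simp only [hf₃]
      ring
  have H3 : HasACDeriv f₃ f₄ := by
    refine (hasACDeriv_of_weight_mul (f₁ := f₃) (F' := fun x => 6 * f₂ x + 4 * x * f₃ x - g₂ x)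
      ?_).congr_right_on fun x hx => ?_
    · refine (((((H1.const_mul 2).add ((hasACDeriv_id.const_mul 4).mul H2))).sub G1).congr_left
        fun x hx => ?_).congr_right_on fun x _ => ?_
      · have := weight_ne hx
        simp only [hf₃, hg₁]
        field_simp
      · ring
    · simp only [hf₄]
      ring
  obtain ⟨h3, h4⟩ := acLocUpTo_of_chain H0 H1 H2 H3
  refine ⟨h3, ?_⟩
  have L1 : SqInt f₁ := domA_deriv_sqInt hf
  have L1g : SqInt g₁ := domA_deriv_sqInt hg
  obtain ⟨C, hC⟩ := G0.exists_bound L1g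
  have L2 : SqInt f₂ := by
    -- The equation alone only bounds (1 - x²)f₂. The gain comes from (p² f₂)' = p(2f₁ - g₁), where
    -- p = 1 - x² and the terms in f₂ cancel: the Hardy inequality with k = 1 then removes both
    -- powers of p.
    have hq : HasACDeriv (fun x => (1 - (x : ℂ) ^ 2) ^ 2 * f₂ x)
        (fun x => (1 - (x : ℂ) ^ 2) ^ 1 * (2 * f₁ x - g₁ x)) := by
      refine ((hasACDeriv_weight.mul (hasACDeriv_weight.mul H2)).congr_left
        fun x _ => ?_).congr_right_on fun x hx => ?_
      · ring
      · have := weight_ne hx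
        simp only [hf₃]
        field_simp
        ring
    have hv : VanishesAtEnds (fun x => (1 - (x : ℂ) ^ 2) ^ 2 * f₂ x) := by
      refine ((hf.2.continuous_mul (by fun_prop : Continuous fun x : ℝ => 2 * (x : ℂ))).sub
        (vanishesAtEnds_weight.bdd_mul hC)).congr_on fun x hx => ?_
      have := weight_ne hx
      simp only [hf₂]
      field_simp
      ring
    refine (hq.hardy_outer 1 hv ((L1.mul_continuous continuous_const).sub' L1g)).congr_on
      fun x hx => mul_div_cancel_left₀ _ (pow_ne_zero _ (weight_ne hx))
  have L3 : SqInt (fun x => (1 - (x : ℂ) ^ 2) * f₃ x) := by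
    refine (((L1.mul_continuous (g := fun _ => 2) continuous_const).add' (L2.mul_continuous
      (by fun_prop : Continuous fun x : ℝ => 4 * (x : ℂ)))).sub' L1g).congr_on fun x hx => ?_
    have := weight_ne hx
    simp only [hf₃]
    field_simp
  refine SqInt.congr_ae (f := fun x => (1 - (x : ℂ) ^ 2) ^ 2 * f₄ x) ?_ ?_
  · refine (((L2.mul_continuous (by fun_prop : Continuous fun x : ℝ => 6 * (1 - (x : ℂ) ^ 2))).add'
      (L3.mul_continuous (by fun_prop : Continuous fun x : ℝ => 6 * (x : ℂ)))).sub'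
      (domA_weight_deriv2_sqInt hg)).congr_on fun x hx => ?_
    have := weight_ne hx
    simp only [hf₄, hg₂, hg₁]
    field_simp
  · filter_upwards [h4] with x hx
    rw [hx]

/-! ### The square of the Legendre expression -/

lemma form₂_id (f : ℝ → ℂ) (x : ℝ) : form₂ f (fun x => (x : ℂ)) x
    = x * form₂ f (fun _ => 1) x - (1 - (x : ℂ) ^ 2) ^ 2 * iteratedDeriv 2 f x
      + 2 * ((1 - (x : ℂ) ^ 2) * f x) := by
  have d0 : deriv (fun x : ℝ => (x : ℂ)) = fun _ => 1 := funext fun x => (hasDerivAt_ofReal x).deriv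
  have d1 : iteratedDeriv 2 (fun x : ℝ => (x : ℂ)) = 0 := by
    rw [iteratedDeriv_succ, iteratedDeriv_one, d0]
    funext x
    simp
  have d2 : iteratedDeriv 2 (fun _ : ℝ => (1 : ℂ)) = 0 := by
    rw [iteratedDeriv_succ, iteratedDeriv_one]
    funext x
    simp
  simp only [form₂, star_one, Complex.star_def, Complex.conj_ofReal, d0, d1, d2, deriv_const]
  simp
  ring

namespace ACLocUpTo

variable {f : ℝ → ℂ}

lemma ell_hasACDeriv (h : ACLocUpTo 3 f) :
    HasACDeriv (fun x => 2 * x * deriv f x - (1 - (x : ℂ) ^ 2) * iteratedDeriv 2 f x)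
      (fun x => 2 * deriv f x + 4 * x * iteratedDeriv 2 f x
        - (1 - (x : ℂ) ^ 2) * iteratedDeriv 3 f x) := by
  obtain ⟨h0, h1, h2, h3⟩ := h.chain
  exact (((hasACDeriv_id.const_mul 2).mul h1).sub (hasACDeriv_weight.mul h2)).congr_right_on
    fun x _ => by ring

lemma flux_hasACDeriv (h : ACLocUpTo 3 f) :
    HasACDeriv (fun x => (1 - (x : ℂ) ^ 2) * deriv f x)
      (fun x => -(2 * x * deriv f x - (1 - (x : ℂ) ^ 2) * iteratedDeriv 2 f x)) :=
  (hasACDeriv_weight.mul h.chain.2.1).congr_right_on fun x _ => by ring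

lemma ell_eqOn (h : ACLocUpTo 3 f) : EqOn (ell f)
    (fun x => 2 * x * deriv f x - (1 - (x : ℂ) ^ 2) * iteratedDeriv 2 f x) I :=
  h.chain.1.ell_eqOn h.chain.2.1.continuousOn h.flux_hasACDeriv h.ell_hasACDeriv.continuousOn

lemma weight_sq_hasACDeriv (h : ACLocUpTo 3 f) :
    HasACDeriv (fun x => (1 - (x : ℂ) ^ 2) ^ 2 * iteratedDeriv 2 f x)
      (fun x => (1 - (x : ℂ) ^ 2) ^ 2 * iteratedDeriv 3 f x
        - 4 * x * (1 - (x : ℂ) ^ 2) * iteratedDeriv 2 f x) :=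
  ((hasACDeriv_weight.mul (hasACDeriv_weight.mul h.chain.2.2.1)).congr_left
    fun x _ => by ring).congr_right_on fun x _ => by ring

lemma weight_sq_hasACDeriv2 (h : ACLocUpTo 3 f) :
    HasACDeriv (fun x => (1 - (x : ℂ) ^ 2) ^ 2 * iteratedDeriv 3 f x
        - 4 * x * (1 - (x : ℂ) ^ 2) * iteratedDeriv 2 f x)
      (fun x => (1 - (x : ℂ) ^ 2) ^ 2 * iteratedDeriv 4 f x
        - 8 * x * ((1 - (x : ℂ) ^ 2) * iteratedDeriv 3 f x)
        + (12 * (x : ℂ) ^ 2 - 4) * iteratedDeriv 2 f x) := by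
  obtain ⟨h0, h1, h2, h3⟩ := h.chain
  refine (((hasACDeriv_weight.mul (hasACDeriv_weight.mul h3)).sub
    ((hasACDeriv_id.const_mul 4).mul (hasACDeriv_weight.mul h2))).congr_left
    fun x _ => by ring).congr_right_on fun x _ => by ring

lemma deriv_weight_sq_eqOn (h : ACLocUpTo 3 f) :
    EqOn (deriv fun x : ℝ => (1 - (x : ℂ) ^ 2) ^ 2 * iteratedDeriv 2 f x)
      (fun x => (1 - (x : ℂ) ^ 2) ^ 2 * iteratedDeriv 3 f x
        - 4 * x * (1 - (x : ℂ) ^ 2) * iteratedDeriv 2 f x) I :=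
  h.weight_sq_hasACDeriv.deriv_eqOn h.weight_sq_hasACDeriv2.continuousOn

lemma ellSq_ae (h : ACLocUpTo 3 f) : ellSq f =ᵐ[μI] fun x =>
    (1 - (x : ℂ) ^ 2) ^ 2 * iteratedDeriv 4 f x
      - 8 * x * ((1 - (x : ℂ) ^ 2) * iteratedDeriv 3 f x)
      + (14 * (x : ℂ) ^ 2 - 6) * iteratedDeriv 2 f x + 4 * x * deriv f x := by
  have e1 := (h.weight_sq_hasACDeriv2.congr_left h.deriv_weight_sq_eqOn.symm).deriv_ae
  filter_upwards [e1, h.flux_hasACDeriv.deriv_ae] with x h1 h2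
  rw [ellSq, h2, iteratedDeriv_succ, iteratedDeriv_one, h1]
  ring

/-- With p = 1 - x², the flux of ℓ[f] is p(ℓ[f])' = 2p f' - (p² f'')', whose derivative is -ℓ²[f] by
inspection. Hence ℓ² is ℓ∘ℓ, and end conditions on this flux are end conditions for ℓ[f]. -/
lemma flux_ell_hasACDeriv (h : ACLocUpTo 3 f) :
    HasACDeriv (fun x => (1 - (x : ℂ) ^ 2) * (2 * deriv f x + 4 * x * iteratedDeriv 2 f x
        - (1 - (x : ℂ) ^ 2) * iteratedDeriv 3 f x)) (fun x => -ellSq f x) := by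
  obtain ⟨h0, h1, h2, h3⟩ := h.chain
  refine (((hasACDeriv_weight.mul (h1.const_mul 2)).sub h.weight_sq_hasACDeriv2).congr_left
    fun x _ => by ring).congr_right ?_
  filter_upwards [h.ellSq_ae] with x hx
  rw [hx]
  ring

lemma ell_ell_ae (h : ACLocUpTo 3 f) : ell (ell f) =ᵐ[μI] ellSq f := by
  have h1 := h.ell_hasACDeriv.ell_ae ?_ h.flux_ell_hasACDeriv
  · filter_upwards [h1, ae_restrict_mem measurableSet_Ioo] with x hx hxI
    rw [← hx]
    exact LegendreSquare.ell_eqOn h.ell_eqOn hxI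
  · exact (hasACDeriv_of_weight_mul h.flux_ell_hasACDeriv).continuousOn

/-- Membership in the domain of `A²` from the end conditions on the two fluxes. -/
lemma mem_domASq (h : ACLocUpTo 3 f) (hL : SqInt f) (hS : SqInt (ellSq f))
    (h0 : VanishesAtEnds (fun x : ℝ => (1 - (x : ℂ) ^ 2) * deriv f x))
    (h1 : VanishesAtEnds (fun x : ℝ => (1 - (x : ℂ) ^ 2) * (2 * deriv f x
      + 4 * x * iteratedDeriv 2 f x - (1 - (x : ℂ) ^ 2) * iteratedDeriv 3 f x))) :
    f ∈ domASq := by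
  have hL1 := sqInt_of_flux h.flux_ell_hasACDeriv h1 hS
  have hg := h.ell_hasACDeriv.sqInt hL1
  exact ⟨domA_of_flux h.chain.1 h.chain.2.1.continuousOn h.flux_hasACDeriv h0 hL hg,
    domA_congr (domA_of_flux h.ell_hasACDeriv
      (hasACDeriv_of_weight_mul h.flux_ell_hasACDeriv).continuousOn h.flux_ell_hasACDeriv h1 hg hS)
      h.ell_eqOn.symm⟩

/-- The boundary form against 1 is minus the flux of ℓ[f], so its vanishing is exactly the end
condition for ℓ[f] to lie in D(A). -/
lemma form₂_one (h : ACLocUpTo 3 f) : EqOn (form₂ f (fun _ => 1))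
    (fun x => -((1 - (x : ℂ) ^ 2) * (2 * deriv f x
      + 4 * x * iteratedDeriv 2 f x - (1 - (x : ℂ) ^ 2) * iteratedDeriv 3 f x))) I := by
  intro x hx
  have e := h.deriv_weight_sq_eqOn hx
  have d1 : iteratedDeriv 2 (fun _ : ℝ => (1 : ℂ)) = 0 := by
    rw [iteratedDeriv_succ, iteratedDeriv_one]
    funext x
    simp
  simp only [form₂, e, star_one, d1, deriv_const]
  simp
  ring

/-- Two applications of `HasACDeriv.hardy_inner` remove the weights one power at a time; below f''
no weight is left and each antiderivative is bounded. -/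
lemma sqInt_iteratedDeriv (h : ACLocUpTo 3 f)
    (hL : SqInt (fun x : ℝ => (1 - (x : ℂ) ^ 2) ^ 2 * iteratedDeriv 4 f x)) :
    SqInt (fun x => (1 - (x : ℂ) ^ 2) * iteratedDeriv 3 f x) ∧ SqInt (iteratedDeriv 2 f) ∧
      SqInt (deriv f) ∧ SqInt f := by
  obtain ⟨h0, h1, h2, h3⟩ := h.chain
  have L3 : SqInt (fun x => (1 - (x : ℂ) ^ 2) * iteratedDeriv 3 f x) :=
    (h3.hardy_inner 1 hL).congr_on fun x _ => by simp
  have L2 : SqInt (iteratedDeriv 2 f) :=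
    (h2.hardy_inner 0 (by simpa using L3)).congr_on fun x _ => by simp
  have L1 := h1.sqInt L2
  exact ⟨L3, L2, L1, h0.sqInt L1⟩

end ACLocUpTo

/-- The weighted bound on f⁗ is the strongest description analytically: it yields every end
condition. Conditions (iii) and (iv) return to D(A²) through the two fluxes, of f and of ℓ[f]. -/
lemma domASq_tfae (f : ℝ → ℂ) : List.TFAE
      [ f ∈ domASq,
        ACLocUpTo 3 f ∧ SqInt (fun x : ℝ => (1 - (x : ℂ) ^ 2) ^ 2 * iteratedDeriv 4 f x),
        f ∈ maxDomain₂ ∧ VanishesAtEnds (form₂ f (fun _ => 1)) ∧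
          VanishesAtEnds (form₂ f (fun x => (x : ℂ))),
        f ∈ maxDomain₂ ∧ VanishesAtEnds (fun x : ℝ => (1 - (x : ℂ) ^ 2) * deriv f x) ∧
          VanishesAtEnds
            (deriv (fun x : ℝ => (1 - (x : ℂ) ^ 2) ^ 2 * iteratedDeriv 2 f x)) ] := by
  have ends : ∀ {f : ℝ → ℂ}, ACLocUpTo 3 f →
      SqInt (fun x : ℝ => (1 - (x : ℂ) ^ 2) ^ 2 * iteratedDeriv 4 f x) →
      f ∈ maxDomain₂ ∧ VanishesAtEnds (fun x : ℝ => (1 - (x : ℂ) ^ 2) * f x) ∧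
      VanishesAtEnds (fun x : ℝ => (1 - (x : ℂ) ^ 2) * deriv f x) ∧
      VanishesAtEnds (fun x : ℝ => (1 - (x : ℂ) ^ 2) * iteratedDeriv 2 f x) ∧
      VanishesAtEnds (fun x : ℝ => (1 - (x : ℂ) ^ 2) ^ 2 * iteratedDeriv 3 f x) := by
    intro f h hL
    obtain ⟨h0, h1, h2, h3⟩ := h.chain
    obtain ⟨L3, L2, L1, L0⟩ := h.sqInt_iteratedDeriv hL
    obtain ⟨C0, hC0⟩ := h0.exists_bound L1
    obtain ⟨C1, hC1⟩ := h1.exists_bound L2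
    refine ⟨⟨h, L0, ?_⟩, ?_, ?_, ?_, ?_⟩
    · refine SqInt.congr_ae ?_ h.ellSq_ae.symm
      exact ((hL.sub' (L3.mul_continuous (by fun_prop : Continuous fun x : ℝ => 8 * (x : ℂ)))).add'
        (L2.mul_continuous (by fun_prop : Continuous fun x : ℝ => 14 * (x : ℂ) ^ 2 - 6))).add'
        (L1.mul_continuous (by fun_prop : Continuous fun x : ℝ => 4 * (x : ℂ)))
    · exact (vanishesAtEnds_weight.bdd_mul hC0).congr_on fun x _ => mul_comm _ _
    · exact (vanishesAtEnds_weight.bdd_mul hC1).congr_on fun x _ => mul_comm _ _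
    · refine (hasACDeriv_weight.mul h2).vanishesAtEnds ?_ (L2.congr_on fun x hx => ?_)
      · exact (L2.mul_continuous (by fun_prop : Continuous fun x : ℝ => -(2 * (x : ℂ)))).add' L3
      · rw [mul_div_cancel_left₀ _ (weight_ne hx)]
    · have := hasACDeriv_weight.mul (hasACDeriv_weight.mul h3)
      refine (this.vanishesAtEnds ?_ (L3.congr_on fun x hx => ?_)).congr_on fun x _ => by ring
      · refine (hL.sub' (L3.mul_continuous (by fun_prop : Continuous fun x : ℝ =>
          4 * (x : ℂ)))).congr_on fun x _ => by ring
      · rw [mul_div_cancel_left₀ _ (weight_ne hx)]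
  tfae_have 1 → 2 := acLocUpTo_of_domASq
  tfae_have 2 → 4 := by
    rintro ⟨h, hL⟩
    obtain ⟨hm, -, v1, v2, v3⟩ := ends h hL
    refine ⟨hm, v1, ?_⟩
    refine (v3.sub (v2.continuous_mul (by fun_prop : Continuous fun x : ℝ =>
      4 * (x : ℂ)))).congr_on fun x hx => ?_
    beta_reduce
    rw [h.deriv_weight_sq_eqOn hx]
    ring
  tfae_have 2 → 3 := by
    rintro ⟨h, hL⟩
    obtain ⟨hm, v0, v1, v2, v3⟩ := ends h hL
    have w1 : VanishesAtEnds (form₂ f (fun _ => 1)) := by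
      refine ((v3.sub (v2.continuous_mul (by fun_prop : Continuous fun x : ℝ =>
        4 * (x : ℂ)))).sub (v1.continuous_mul (h := fun _ => 2) continuous_const)).congr_on
        fun x hx => ?_
      beta_reduce
      rw [h.form₂_one hx]
      ring
    refine ⟨hm, w1, ?_⟩
    refine (((w1.continuous_mul Complex.continuous_ofReal).sub (v2.continuous_mul
      (by fun_prop : Continuous fun x : ℝ => 1 - (x : ℂ) ^ 2))).add
      (v0.continuous_mul (h := fun _ => 2) continuous_const)).congr_on fun x hx => ?_
    beta_reduce
    rw [form₂_id]
    ring
  tfae_have 4 → 1 := by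
    rintro ⟨⟨h, hL, hS⟩, v1, v2⟩
    refine h.mem_domASq hL hS v1 ?_
    refine ((v1.continuous_mul (h := fun _ => 2) continuous_const).sub v2).congr_on fun x hx => ?_
    beta_reduce
    rw [h.deriv_weight_sq_eqOn hx]
    ring
  tfae_have 3 → 1 := by
    rintro ⟨⟨h, hL, hS⟩, w1, w2⟩
    have hK : VanishesAtEnds (fun x : ℝ => (1 - (x : ℂ) ^ 2) * (2 * deriv f x
      + 4 * x * iteratedDeriv 2 f x - (1 - (x : ℂ) ^ 2) * iteratedDeriv 3 f x)) := by
      refine (w1.continuous_mul (h := fun _ => -1) continuous_const).congr_on fun x hx => ?_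
      beta_reduce
      rw [h.form₂_one hx]
      ring
    refine h.mem_domASq hL hS ?_ hK
    have hL1 := sqInt_of_flux h.flux_ell_hasACDeriv hK hS
    obtain ⟨C, hC⟩ := h.ell_hasACDeriv.exists_bound hL1
    have hg := h.ell_hasACDeriv.sqInt hL1
    obtain ⟨D, hD⟩ := h.flux_hasACDeriv.exists_bound hg.neg'
    have hF := h.flux_hasACDeriv.sqInt hg.neg'
    have hpf : VanishesAtEnds (fun x : ℝ => (1 - (x : ℂ) ^ 2) * f x) := by
      refine (hasACDeriv_weight.mul h.chain.1).vanishesAtEnds ?_ (hL.congr_on fun x hx => ?_)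
      · exact (hL.mul_continuous (by fun_prop : Continuous fun x : ℝ => -(2 * (x : ℂ)))).add' hF
      · rw [mul_div_cancel_left₀ _ (weight_ne hx)]
    -- With p = 1 - x², inserting p² f'' = 2x p f' - p ℓ[f] in `form₂_id` gives 2x p f' = x[f,1]₂ +
    -- 2p f + p ℓ[f] - [f,x]₂, and every term on the right tends to 0.
    have hxF : VanishesAtEnds (fun x : ℝ => (x : ℂ) * ((1 - (x : ℂ) ^ 2) * deriv f x)) := by
      have := ((((w1.continuous_mul Complex.continuous_ofReal).add
        (hpf.continuous_mul (h := fun _ => 2) continuous_const)).add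
        (vanishesAtEnds_weight.bdd_mul hC)).sub w2).continuous_mul (h := fun _ => 1 / 2)
        continuous_const
      refine this.congr_on fun x hx => ?_
      beta_reduce
      rw [form₂_id]
      ring
    -- The factor x is removed without division: x² + (1 - x²) = 1, and the flux is bounded.
    refine ((hxF.continuous_mul Complex.continuous_ofReal).add
      (vanishesAtEnds_weight.bdd_mul hD)).congr_on fun x _ => ?_
    ring
  tfae_finish

/-! ### Operators that are diagonal in a Hilbert basis -/

section Diagonal

variable {H : Type*} [NormedAddCommGroup H] [InnerProductSpace ℂ H]

/-- `T` is the maximal operator that multiplies the `n`-th coordinate in the basis `b` by `l n`. -/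
def IsDiagonal (T : H →ₗ.[ℂ] H) (b : HilbertBasis ℕ ℂ H) (l : ℕ → ℝ) : Prop :=
  ∀ u v : H, (∃ h : u ∈ T.domain, T ⟨u, h⟩ = v) ↔
    ∀ n, inner ℂ (b n) v = (l n : ℂ) * inner ℂ (b n) u

lemma hilbertBasis_ext (b : HilbertBasis ℕ ℂ H) {x y : H}
    (h : ∀ n, inner ℂ (b n) x = inner ℂ (b n) y) : x = y := by
  refine b.repr.injective (lp.ext (funext fun n => ?_))
  rw [b.repr_apply_apply, b.repr_apply_apply, h n]

lemma inner_hilbertBasis (b : HilbertBasis ℕ ℂ H) (m n : ℕ) :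
    inner ℂ (b m) (b n) = if m = n then (1 : ℂ) else 0 :=
  orthonormal_iff_ite.1 b.orthonormal m n

/-- A sequence dominated by a multiple of the coordinates of x is square summable, hence is itself a
sequence of coordinates. -/
lemma exists_coords (b : HilbertBasis ℕ ℂ H) {x : H} {c : ℕ → ℂ} {M : ℝ} (hM : 0 ≤ M)
    (hc : ∀ n, ‖c n‖ ≤ M * ‖(inner ℂ (b n) x : ℂ)‖) :
    ∃ y : H, (∀ n, inner ℂ (b n) y = c n) ∧ ‖y‖ ≤ M * ‖x‖ := by
  have hc' : ∀ n, ‖c n‖ ≤ ‖((M : ℂ) • b.repr x) n‖ := fun n => by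
    rw [lp.coeFn_smul, Pi.smul_apply, norm_smul, b.repr_apply_apply, Complex.norm_real,
      Real.norm_of_nonneg hM]
    exact hc n
  have hm : Memℓp c 2 := (lp.memℓp ((M : ℂ) • b.repr x)).mono' hc'
  refine ⟨b.repr.symm ⟨c, hm⟩, fun n => ?_, ?_⟩
  · rw [← b.repr_apply_apply, LinearIsometryEquiv.apply_symm_apply]
  · have e : M * ‖x‖ = ‖(M : ℂ) • b.repr x‖ := by
      rw [norm_smul, Complex.norm_real, Real.norm_of_nonneg hM, LinearIsometryEquiv.norm_map]
    have h2 : 0 < (2 : ENNReal).toReal := by norm_num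
    rw [LinearIsometryEquiv.norm_map, e]
    refine lp.norm_le_of_tsum_le h2 (norm_nonneg _) ?_
    rw [lp.norm_rpow_eq_tsum h2]
    refine Summable.tsum_le_tsum (fun n => ?_) (hm.summable h2) ((lp.memℓp _).summable h2)
    exact Real.rpow_le_rpow (norm_nonneg _) (hc' n) h2.le

namespace IsDiagonal

variable {T : H →ₗ.[ℂ] H} {b : HilbertBasis ℕ ℂ H} {l : ℕ → ℝ}

lemma apply (hT : IsDiagonal T b l) (u : T.domain) (n : ℕ) :
    inner ℂ (b n) (T u) = (l n : ℂ) * inner ℂ (b n) (u : H) :=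
  (hT u (T u)).1 ⟨u.2, rfl⟩ n

lemma exists_apply_basis (hT : IsDiagonal T b l) (n : ℕ) :
    ∃ h : b n ∈ T.domain, T ⟨b n, h⟩ = (l n : ℂ) • b n := by
  refine (hT _ _).2 fun m => ?_
  rw [inner_smul_right, inner_hilbertBasis]
  split_ifs with h
  · rw [h]
  · simp

lemma square (hT : IsDiagonal T b l) : IsDiagonal (square T) b (fun n => l n ^ 2) := by
  intro u w
  constructor
  · rintro ⟨⟨h, h'⟩, e⟩ n
    change T ⟨T ⟨u, h⟩, h'⟩ = w at e
    rw [← e, hT.apply, hT.apply]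
    push_cast
    ring
  · intro hw
    -- The intermediate vector T u must be built: its coordinates l u are dominated by those of u +
    -- w, which are (1 + l²)u, because |l| ≤ 1 + l².
    obtain ⟨v, hv, -⟩ := exists_coords b (x := u + w)
      (c := fun n => (l n : ℂ) * inner ℂ (b n) u) zero_le_one fun n => by
        have e : inner ℂ (b n) (u + w) = ((1 + l n ^ 2 : ℝ) : ℂ) * inner ℂ (b n) u := by
          rw [inner_add_right, hw n]
          push_cast
          ring
        rw [e, one_mul, norm_mul, norm_mul, Complex.norm_real, Complex.norm_real]
        refine mul_le_mul_of_nonneg_right ?_ (norm_nonneg _)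
        rw [Real.norm_eq_abs, Real.norm_of_nonneg (by positivity)]
        exact abs_le.2 ⟨by nlinarith [sq_nonneg (l n + 1)], by nlinarith [sq_nonneg (l n - 1)]⟩
    obtain ⟨h1, e1⟩ := (hT u v).2 hv
    obtain ⟨h2, e2⟩ := (hT v w).2 fun n => by
      rw [hw n, hv n]
      push_cast
      ring
    subst e1
    exact ⟨⟨h1, h2⟩, e2⟩

lemma dense_domain (hT : IsDiagonal T b l) : Dense (T.domain : Set H) := by
  have h : Submodule.span ℂ (range b) ≤ T.domain :=
    Submodule.span_le.2 (range_subset_iff.2 fun n => (hT.exists_apply_basis n).fst)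
  have h2 : Dense ((Submodule.span ℂ (range b) : Submodule ℂ H) : Set H) :=
    (Submodule.dense_iff_topologicalClosure_eq_top).2 b.dense_span
  exact h2.mono h

/-- Testing the adjoint relation on basis vectors gives the coordinate relation, which by maximality
is membership in the graph; the converse is Parseval with real l. -/
lemma isSelfAdjoint [CompleteSpace H] (hT : IsDiagonal T b l) : IsSelfAdjoint T := by
  rw [LinearPMap.isSelfAdjoint_def]
  refine LinearPMap.eq_of_eq_graph ?_
  rw [LinearPMap.adjoint_graph_eq_graph_adjoint hT.dense_domain]
  ext ⟨x, y⟩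
  rw [Submodule.mem_adjoint_iff]
  have hg : ∀ u v : H, (u, v) ∈ T.graph ↔ ∀ n, inner ℂ (b n) v = (l n : ℂ) * inner ℂ (b n) u := by
    intro u v
    rw [← hT u v, LinearPMap.mem_graph_iff]
    constructor
    · rintro ⟨⟨y, hy⟩, rfl, h⟩
      exact ⟨hy, h⟩
    · rintro ⟨h, e⟩
      exact ⟨⟨u, h⟩, rfl, e⟩
  rw [hg]
  constructor
  · intro h n
    obtain ⟨hn, e⟩ := hT.exists_apply_basis n
    have := h (b n) ((l n : ℂ) • b n) ((hg _ _).2 ((hT _ _).1 ⟨hn, e⟩))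
    rw [inner_smul_left, Complex.conj_ofReal, sub_eq_zero] at this
    exact this.symm
  · intro h u v huv
    rw [hg] at huv
    rw [← b.tsum_inner_mul_inner, ← b.tsum_inner_mul_inner, sub_eq_zero]
    refine tsum_congr fun n => ?_
    rw [h n, ← inner_conj_symm v (b n), huv n, ← inner_conj_symm u (b n), map_mul,
      Complex.conj_ofReal]
    ring

lemma eigenvalue_mem_spectrum (hT : IsDiagonal T b l) (n : ℕ) : (l n : ℂ) ∈ spectrumOf T := by
  rintro ⟨R, -, hR⟩
  obtain ⟨h, e⟩ := hT.exists_apply_basis n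
  have := hR ⟨b n, h⟩
  rw [e, sub_self, map_zero] at this
  exact b.orthonormal.ne_zero n this.symm

/-- The resolvent divides the n-th coordinate by l n - z, so its norm is at most δ⁻¹. -/
lemma notMem_spectrum (hT : IsDiagonal T b l) {z : ℂ} {δ : ℝ} (hδ : 0 < δ)
    (hz : ∀ n, δ ≤ ‖(l n : ℂ) - z‖) : z ∉ spectrumOf T := by
  have hne : ∀ n, (l n : ℂ) - z ≠ 0 := fun n => norm_pos_iff.1 (hδ.trans_le (hz n))
  have hex : ∀ x : H, ∃ y : H, (∀ n, inner ℂ (b n) y = ((l n : ℂ) - z)⁻¹ * inner ℂ (b n) x) ∧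
      ‖y‖ ≤ δ⁻¹ * ‖x‖ := fun x => exists_coords b (inv_nonneg.2 hδ.le) fun n => by
    rw [norm_mul, norm_inv]
    exact mul_le_mul_of_nonneg_right (inv_anti₀ hδ (hz n)) (norm_nonneg _)
  choose R hR hRn using hex
  let R' : H →L[ℂ] H := LinearMap.mkContinuous
    { toFun := R
      map_add' := fun x y => hilbertBasis_ext b fun n => by
        simp only [inner_add_right, hR]
        ring
      map_smul' := fun c x => hilbertBasis_ext b fun n => by
        simp only [inner_smul_right, hR, RingHom.id_apply]
        ring } δ⁻¹ hRn
  have hR' : ∀ x, R' x = R x := fun x => rfl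
  refine fun hzs => hzs ⟨R', fun v => ?_, fun u => ?_⟩
  · obtain ⟨h, e⟩ := (hT (R v) (v + z • R v)).2 fun n => by
      rw [inner_add_right, inner_smul_right, hR]
      have := hne n
      field_simp
      ring
    refine ⟨h, ?_⟩
    change T ⟨R v, h⟩ - z • R v = v
    rw [e, add_sub_cancel_right]
  · rw [hR']
    refine hilbertBasis_ext b fun n => ?_
    rw [hR, inner_sub_right, inner_smul_right, hT.apply]
    have := hne n
    field_simp

lemma spectrumOf_eq (hT : IsDiagonal T b l) (hl : ∀ m n, m ≠ n → 1 ≤ |l m - l n|) :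
    spectrumOf T = range (fun n => (l n : ℂ)) := by
  refine Subset.antisymm (fun z hz => ?_) (range_subset_iff.2 hT.eigenvalue_mem_spectrum)
  by_contra hzr
  have hne : ∀ n, 0 < ‖(l n : ℂ) - z‖ := fun n =>
    norm_pos_iff.2 (sub_ne_zero.2 fun e => hzr ⟨n, e⟩)
  by_cases hh : ∀ n, 1 / 2 ≤ ‖(l n : ℂ) - z‖
  · exact hT.notMem_spectrum (by norm_num) hh hz
  push Not at hh
  obtain ⟨m, hm⟩ := hh
  -- At most one value l m lies within 1/2 of z, and then every other one is at least 1 - ‖l m - z‖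
  -- ≥ ‖l m - z‖ away, so that distance serves as δ.
  refine hT.notMem_spectrum (hne m) (fun n => ?_) hz
  by_cases hnm : n = m
  · rw [hnm]
  have h1 := hl n m hnm
  have h2 : |l n - l m| ≤ ‖(l n : ℂ) - z‖ + ‖(l m : ℂ) - z‖ := by
    have := norm_sub_le ((l n : ℂ) - z) ((l m : ℂ) - z)
    rwa [sub_sub_sub_cancel_right, ← Complex.ofReal_sub, Complex.norm_real] at this
  linarith

lemma hasDiscreteSpectrum (hT : IsDiagonal T b l) (hl : ∀ m n, m ≠ n → 1 ≤ |l m - l n|) :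
    HasDiscreteSpectrum T := by
  intro z hz
  rw [hT.spectrumOf_eq hl] at hz ⊢
  obtain ⟨m, rfl⟩ := hz
  refine ⟨fun hacc => ?_, ?_, ?_⟩
  · rw [accPt_iff_nhds] at hacc
    obtain ⟨y, ⟨hy1, n, rfl⟩, hy2⟩ := hacc _ (Metric.ball_mem_nhds _ one_pos)
    have hnm : n ≠ m := fun e => hy2 (by rw [e])
    have := hl n m hnm
    simp only [Metric.mem_ball, Complex.dist_eq, ← Complex.ofReal_sub, Complex.norm_real,
      Real.norm_eq_abs] at hy1
    linarith
  · obtain ⟨h, e⟩ := hT.exists_apply_basis m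
    refine (Submodule.ne_bot_iff _).2 ⟨⟨b m, h⟩, ?_, ?_⟩
    · rw [eigenspaceOf, LinearMap.mem_ker]
      change T ⟨b m, h⟩ - (l m : ℂ) • b m = 0
      rw [e, sub_self]
    · intro h0
      exact b.orthonormal.ne_zero m (congrArg Subtype.val h0)
  -- An eigenvector at l m has no coordinate other than the m-th, so that coordinate embeds the
  -- eigenspace in ℂ.
  · let φ : eigenspaceOf T (l m : ℂ) →ₗ[ℂ] ℂ :=
      (innerSL ℂ (b m)).toLinearMap ∘ₗ T.domain.subtype ∘ₗ (eigenspaceOf T (l m : ℂ)).subtype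
    refine FiniteDimensional.of_injective φ ?_
    rw [injective_iff_map_eq_zero]
    intro u hu
    have hu0 : inner ℂ (b m) ((u : T.domain) : H) = 0 := hu
    have hk : T (u : T.domain) - (l m : ℂ) • ((u : T.domain) : H) = 0 := LinearMap.mem_ker.1 u.2
    refine Subtype.ext (Subtype.ext (hilbertBasis_ext b fun n => ?_))
    change _ = inner ℂ (b n) (0 : H)
    rw [inner_zero_right]
    by_cases hnm : n = m
    · rw [hnm, hu0]
    have e1 := congrArg (inner ℂ (b n)) hk
    rw [inner_sub_right, inner_smul_right, hT.apply, inner_zero_right, ← sub_mul,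
      ← Complex.ofReal_sub] at e1
    refine (mul_eq_zero.1 e1).resolve_left fun e2 => ?_
    have := hl n m hnm
    rw [Complex.ofReal_eq_zero.1 e2, abs_zero] at this
    linarith

end IsDiagonal

end Diagonal

/-! ### The operators `A` and `A²` -/

lemma exists_opA_apply_iff {u v : L2} : (∃ h : u ∈ opA.domain, opA ⟨u, h⟩ = v) ↔
    ∃ f ∈ domA, u =ᵐ[μI] f ∧ v =ᵐ[μI] ell f := by
  constructor
  · rintro ⟨⟨f, hf, hu⟩, rfl⟩
    exact ⟨f, hf, hu, opA_apply _ hf hu⟩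
  · rintro ⟨f, hf, hu, hv⟩
    exact ⟨⟨f, hf, hu⟩, Lp.ext ((opA_apply ⟨u, ⟨f, hf, hu⟩⟩ hf hu).trans hv.symm)⟩

lemma mem_opT_domain_iff (u : L2) : u ∈ opT.domain ↔ ∃ f ∈ domASq, u =ᵐ[μI] f := by
  constructor
  · rintro ⟨⟨f, hf, hu⟩, ⟨g, hg, hv⟩⟩
    have e : ell f =ᵐ[μI] g := (opA_apply ⟨u, ⟨f, hf, hu⟩⟩ hf hu).symm.trans hv
    -- Almost everywhere equality is not enough for membership in the function domain. Since g is
    -- continuous, the flux of f is differentiable everywhere with derivative -g, so ℓ[f] = g at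
    -- every point.
    have e' : EqOn (ell f) g I := (domA_hasACDeriv hf).ell_eqOn (domA_acLoc_deriv hf).continuousOn
      ((domA_flux hf).congr_right (e.fun_comp Neg.neg)) (domA_acLoc hg).continuousOn
    exact ⟨f, ⟨hf, domA_congr hg e'.symm⟩, hu⟩
  · rintro ⟨f, ⟨hf, hg⟩, hu⟩
    exact ⟨⟨f, hf, hu⟩, ⟨ell f, hg, opA_apply _ hf hu⟩⟩

lemma opT_apply (u : opT.domain) {f : ℝ → ℂ} (hf : f ∈ domASq) (hu : (u : L2) =ᵐ[μI] f) :
    opT u =ᵐ[μI] ellSq f := by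
  have h1 : opA ⟨u, u.2.fst⟩ =ᵐ[μI] ell f := opA_apply _ hf.1 hu
  exact (opA_apply ⟨opA ⟨u, u.2.fst⟩, u.2.snd⟩ hf.2 h1).trans (acLocUpTo_of_domASq hf).1.ell_ell_ae

/-- Green's formula for the Legendre expression. -/
lemma integral_ell_mul_star {f g : ℝ → ℂ} (hf : f ∈ domA) (hg : g ∈ domA) :
    ∫ x in I, ell f x * star (g x) = ∫ x in I, f x * star (ell g x) := by
  -- In the derivative of p f' ḡ - f p ḡ', where p = 1 - x², the terms p f' ḡ' cancel. The boundary
  -- values vanish because f and g are bounded.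
  have W := ((domA_flux hf).mul (domA_hasACDeriv hg).conj).sub
    ((domA_hasACDeriv hf).mul (domA_flux hg).conj)
  have W' := W.congr_right_on (s := fun x => f x * star (ell g x) - ell f x * star (g x))
    fun x _ => by
      simp only [star_mul', star_neg, star_sub, star_one, star_pow, Complex.star_def,
        Complex.conj_ofReal]
      ring
  obtain ⟨C, hC⟩ := (domA_hasACDeriv hf).exists_bound (domA_deriv_sqInt hf)
  obtain ⟨D, hD⟩ := (domA_hasACDeriv hg).exists_bound (domA_deriv_sqInt hg)
  have hstar : ∀ {h : ℝ → ℂ}, VanishesAtEnds h → VanishesAtEnds (fun x => star (h x)) :=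
    fun hh => ⟨by simpa using hh.1.star, by simpa using hh.2.star⟩
  have V := ((hf.2.bdd_mul (h := fun x => star (g x)) (C := D) fun x hx => by
      rw [norm_star]; exact hD x hx).congr_on fun x _ => mul_comm _ _).sub
    ((hstar hg.2).bdd_mul hC)
  have i1 : IntegrableOn (fun x => f x * star (ell g x)) I :=
    MemLp.integrable_mul hf.1.2.1 hg.1.2.2.star
  have i2 : IntegrableOn (fun x => ell f x * star (g x)) I :=
    MemLp.integrable_mul hf.1.2.2 hg.1.2.1.star
  have := W'.integral_eq_zero (i1.sub i2) V
  rw [integral_sub i1 i2, sub_eq_zero] at this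
  exact this.symm

lemma inner_eq_of_ae {u v : L2} {f g : ℝ → ℂ} (hu : u =ᵐ[μI] f) (hv : v =ᵐ[μI] g) :
    inner ℂ u v = ∫ x in I, g x * star (f x) := by
  rw [L2.inner_def]
  refine integral_congr_ae ?_
  filter_upwards [hu, hv] with x h1 h2
  rw [h1, h2, RCLike.inner_apply]
  rfl

lemma opA_symmetric (u v : opA.domain) :
    inner ℂ (opA u) (v : L2) = inner ℂ (u : L2) (opA v) := by
  obtain ⟨f, hf, hu, hu'⟩ := exists_opA_apply_iff.1 ⟨u.2, rfl⟩
  obtain ⟨g, hg, hv, hv'⟩ := exists_opA_apply_iff.1 ⟨v.2, rfl⟩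
  rw [inner_eq_of_ae hu' hv, inner_eq_of_ae hu hv', integral_ell_mul_star hg hf]

/-- Every function of mean zero is in the range of `A`. -/
lemma exists_opA_eq {v : L2} (hv : ∫ x in I, v x = 0) :
    ∃ (w : L2) (h : w ∈ opA.domain), opA ⟨w, h⟩ = v := by
  have hvL : SqInt v := Lp.memLp v
  have hF := HasACDeriv.of_integrable (r := fun x => -v x) hvL.neg'.integrableOn
  obtain ⟨a, c, hc, ha, hac, -⟩ := hF.exists_limits hvL.neg'.integrableOn
  rw [integral_neg, hv, neg_zero] at hac
  obtain rfl : c = a := (sub_eq_zero.1 hac.symm)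
  -- Mean zero gives the primitive of -v the same limit c at both ends, so subtracting c produces a
  -- flux that vanishes at both.
  set F : ℝ → ℂ := fun x => (∫ t in (-1 : ℝ)..x, -v t) - c with hFdef
  have hF' : HasACDeriv F (fun x => -v x) := (hF.sub (HasACDeriv.const c)).congr_right_on
    fun x _ => sub_zero _
  have hV : VanishesAtEnds F :=
    ⟨sub_self c ▸ hc.sub_const c, sub_self c ▸ ha.sub_const c⟩
  set f₁ : ℝ → ℂ := fun x => F x / (1 - (x : ℂ) ^ 2) with hf₁
  have e : EqOn F (fun x => (1 - (x : ℂ) ^ 2) * f₁ x) I := fun x hx => by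
    have := weight_ne hx
    simp only [hf₁]
    field_simp
  have hF2 := hF'.congr_left e
  have hV2 := hV.congr_on e
  have hL1 := sqInt_of_flux hF2 hV2 hvL
  have hf := HasACDeriv.of_integrable hL1.integrableOn
  have hcont : ContinuousOn f₁ I := (hasACDeriv_of_weight_mul hF2).continuousOn
  have hfL := hf.sqInt hL1
  have hmem := domA_of_flux hf hcont hF2 hV2 hfL hvL
  exact ⟨MemLp.toLp _ hfL, exists_opA_apply_iff.2
    ⟨_, hmem, MemLp.coeFn_toLp hfL, (hf.ell_ae hcont hF2).symm⟩⟩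

/-! ### Polynomials -/

/-- Leibniz's rule, which stops after three terms because X² - 1 has degree 2. -/
lemma iterate_derivative_weight_mul (v : ℂ[X]) (k : ℕ) :
    derivative^[k + 1] ((X ^ 2 - 1) * derivative v)
      = (X ^ 2 - 1) * derivative^[k + 2] v + C (2 * ((k : ℂ) + 1)) * X * derivative^[k + 1] v
        + C (((k : ℂ) + 1) * k) * derivative^[k] v := by
  induction k with
  | zero =>
    simp [derivative_mul, map_ofNat C]
    ring
  | succ k ih =>
    rw [Function.iterate_succ_apply', ih]
    simp only [derivative_add, derivative_mul, derivative_C, derivative_X, derivative_sub,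
      derivative_pow, derivative_one, ← Function.iterate_succ_apply' derivative]
    simp only [map_mul, map_add, map_one, map_natCast, map_ofNat, Nat.cast_add, Nat.cast_one,
      Nat.cast_ofNat]
    ring

lemma iterate_derivative_X_mul' (v : ℂ[X]) (k : ℕ) :
    derivative^[k + 1] (X * v) = X * derivative^[k + 1] v + C ((k : ℂ) + 1) * derivative^[k] v := by
  induction k with
  | zero =>
    simp [derivative_mul]
    ring
  | succ k ih =>
    rw [Function.iterate_succ_apply', ih]
    simp only [derivative_add, derivative_mul, derivative_C, derivative_X,
      ← Function.iterate_succ_apply' derivative]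
    simp only [map_add, map_one, map_natCast, Nat.cast_add, Nat.cast_one]
    ring

/-- Legendre's differential equation. -/
lemma legendreP_ode (n : ℕ) : derivative ((1 - X ^ 2) * derivative (legendreP n))
    = -(C ((n : ℂ) * (n + 1)) * legendreP n) := by
  set u : ℂ[X] := (X ^ 2 - 1) ^ n with hu
  -- Legendre's equation is the (n+1)-st derivative of this first-order equation for u.
  have h0 : (X ^ 2 - 1) * derivative u = C (2 * (n : ℂ)) * (X * u) := by
    rcases n with _ | n
    · simp [hu]
    · simp only [hu, derivative_pow, derivative_sub, derivative_X, derivative_one,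
        map_mul, map_natCast, map_ofNat, Nat.add_sub_cancel]
      push_cast
      ring
  have h1 := congrArg (derivative^[n + 1]) h0
  rw [iterate_derivative_weight_mul, iterate_derivative_C_mul, iterate_derivative_X_mul'] at h1
  set w := derivative^[n] u with hw
  have e1 : derivative^[n + 1] u = derivative w := Function.iterate_succ_apply' _ _ _
  have e2 : derivative^[n + 2] u = derivative (derivative w) := by
    rw [Function.iterate_succ_apply', e1]
  rw [e1, e2] at h1
  have hP : legendreP n = C ((2 ^ n * (n.factorial : ℂ))⁻¹) * w := rfl
  rw [hP]
  simp only [derivative_mul, derivative_C, derivative_sub, derivative_pow, derivative_one,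
    derivative_X, zero_mul, zero_add]
  simp only [map_mul, map_add, map_one, map_natCast, map_ofNat, Nat.cast_ofNat] at h1 ⊢
  linear_combination (-C ((2 ^ n * (n.factorial : ℂ))⁻¹)) * h1

lemma legendreP_degree (n : ℕ) : (legendreP n).degree = n := by
  have hc : (2 ^ n * (n.factorial : ℂ))⁻¹ ≠ 0 := by
    have : (n.factorial : ℂ) ≠ 0 := by exact_mod_cast n.factorial_ne_zero
    exact inv_ne_zero (mul_ne_zero (pow_ne_zero _ two_ne_zero) this)
  have hm : ((X ^ 2 - 1 : ℂ[X]) ^ n).Monic := by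
    refine Monic.pow ?_ n
    have := monic_X_pow_sub_C (1 : ℂ) (n := 2) two_ne_zero
    rwa [map_one] at this
  have hd : ((X ^ 2 - 1 : ℂ[X]) ^ n).natDegree = n + n := by
    have := natDegree_X_pow_sub_C (n := 2) (r := (1 : ℂ))
    rw [map_one] at this
    rw [natDegree_pow, this]
    ring
  rw [legendreP, degree_C_mul hc]
  refine degree_eq_of_le_of_coeff_ne_zero ?_ ?_
  · refine natDegree_le_iff_degree_le.1 ((natDegree_iterate_derivative _ _).trans ?_)
    rw [hd, Nat.add_sub_cancel]
  · rw [coeff_iterate_derivative, ← hd, hm.coeff_natDegree, hd]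
    simp [Nat.descFactorial_eq_zero_iff_lt]

/-- The class of a polynomial in `L²(-1, 1)`. -/
def polyL2 : ℂ[X] →ₗ[ℂ] L2 where
  toFun q := MemLp.toLp (fun x : ℝ => q.eval (x : ℂ)) (sqInt_polynomial q)
  map_add' p q := (MemLp.toLp_congr _ ((sqInt_polynomial p).add (sqInt_polynomial q))
    (Eventually.of_forall fun x => by simp)).trans (MemLp.toLp_add _ _)
  map_smul' c q := (MemLp.toLp_congr _ ((sqInt_polynomial q).const_smul c)
    (Eventually.of_forall fun x => by simp)).trans (MemLp.toLp_const_smul c _)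

lemma polyL2_ae (q : ℂ[X]) : polyL2 q =ᵐ[μI] fun x : ℝ => q.eval (x : ℂ) :=
  MemLp.coeFn_toLp (sqInt_polynomial q)

lemma polyL2_legendreP (n : ℕ) : polyL2 (legendreP n) = legendreL2 n := rfl

lemma hasACDeriv_polynomial (q : ℂ[X]) :
    HasACDeriv (fun x : ℝ => q.eval (x : ℂ)) (fun x : ℝ => (derivative q).eval (x : ℂ)) :=
  HasACDeriv.of_hasDerivAt (fun x _ => (q.hasDerivAt (x : ℂ)).comp_ofReal)
    ((derivative q).continuous.comp Complex.continuous_ofReal).continuousOn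

lemma opA_polyL2 (q : ℂ[X]) : ∃ h : polyL2 q ∈ opA.domain,
    opA ⟨polyL2 q, h⟩ = polyL2 (-derivative ((1 - X ^ 2) * derivative q)) := by
  have h0 := hasACDeriv_polynomial q
  have h1 := hasACDeriv_polynomial ((1 - X ^ 2) * derivative q)
  have hc : Continuous fun x : ℝ => (derivative q).eval (x : ℂ) :=
    (derivative q).continuous.comp Complex.continuous_ofReal
  have h2 : HasACDeriv (fun x : ℝ => (1 - (x : ℂ) ^ 2) * (derivative q).eval (x : ℂ))
      (fun x => -(-derivative ((1 - X ^ 2) * derivative q)).eval (x : ℂ)) :=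
    (h1.congr_left fun x _ => by simp).congr_right_on fun x _ => by simp
  have hv : VanishesAtEnds (fun x : ℝ => (1 - (x : ℂ) ^ 2) * (derivative q).eval (x : ℂ)) :=
    (vanishesAtEnds_weight.continuous_mul hc).congr_on fun x _ => mul_comm _ _
  exact exists_opA_apply_iff.2 ⟨_, domA_of_flux h0 hc.continuousOn h2 hv (sqInt_polynomial _)
    (sqInt_polynomial _), polyL2_ae q, (polyL2_ae _).trans (h0.ell_ae hc.continuousOn h2).symm⟩

lemma opA_legendreL2 (n : ℕ) : ∃ h : legendreL2 n ∈ opA.domain,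
    opA ⟨legendreL2 n, h⟩ = ((n : ℂ) * (n + 1)) • legendreL2 n := by
  obtain ⟨h, e⟩ := opA_polyL2 (legendreP n)
  refine ⟨h, e.trans ?_⟩
  rw [legendreP_ode, neg_neg, ← smul_eq_C_mul, map_smul]
  rfl

lemma polyL2_injective : Function.Injective polyL2 := by
  rw [injective_iff_map_eq_zero]
  intro q hq
  have h1 : (fun x : ℝ => q.eval (x : ℂ)) =ᵐ[μI] fun _ => 0 := by
    have := polyL2_ae q
    rw [hq] at this
    exact this.symm.trans (Lp.coeFn_zero _ _ _)
  have h2 : EqOn (fun x : ℝ => q.eval (x : ℂ)) (fun _ => 0) I :=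
    Measure.eqOn_of_ae_eq h1 (hasACDeriv_polynomial q).continuousOn continuousOn_const
      (by rw [isOpen_Ioo.interior_eq]; exact subset_closure)
  refine Polynomial.eq_zero_of_infinite_isRoot q ?_
  refine ((Ioo_infinite (show (-1 : ℝ) < 1 by norm_num)).image
    Complex.ofReal_injective.injOn).mono ?_
  rintro _ ⟨x, hx, rfl⟩
  exact h2 hx

lemma legendreL2_ne_zero (n : ℕ) : legendreL2 n ≠ 0 := by
  intro h
  have h1 : legendreP n = 0 := polyL2_injective (by rw [polyL2_legendreP, h, map_zero])
  have h2 := legendreP_degree n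
  rw [h1, degree_zero] at h2
  exact absurd h2 (by simp)

/-- There is one Legendre polynomial in each degree, so they span ℂ[X]. -/
lemma span_legendreL2 : Submodule.span ℂ (range legendreL2) = LinearMap.range polyL2 := by
  let S : Polynomial.Sequence ℂ := ⟨legendreP, legendreP_degree⟩
  have hS : Submodule.span ℂ (range legendreP) = ⊤ := S.span fun n =>
    isUnit_iff_ne_zero.2 (leadingCoeff_ne_zero.2 fun h => by
      have h2 := legendreP_degree n
      rw [show legendreP n = 0 from h, degree_zero] at h2
      exact absurd h2 (by simp))
  have h1 : range legendreL2 = polyL2 '' range legendreP := by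
    rw [← range_comp]
    rfl
  rw [h1, ← Submodule.map_span, hS, Submodule.map_top]

/-! ### Weierstrass approximation and density in L². -/

lemma exists_polynomial_near {g : ℝ → ℂ} (hg : Continuous g) {ε : ℝ} (hε : 0 < ε) :
    ∃ q : ℂ[X], ∀ x ∈ I, ‖g x - q.eval (x : ℂ)‖ ≤ ε := by
  obtain ⟨p, hp⟩ := exists_polynomial_near_of_continuousOn (-1) 1 (fun x => (g x).re)
    (Complex.continuous_re.comp hg).continuousOn (ε / 2) (half_pos hε)
  obtain ⟨q, hq⟩ := exists_polynomial_near_of_continuousOn (-1) 1 (fun x => (g x).im)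
    (Complex.continuous_im.comp hg).continuousOn (ε / 2) (half_pos hε)
  refine ⟨p.map (algebraMap ℝ ℂ) + C Complex.I * q.map (algebraMap ℝ ℂ), fun x hx => ?_⟩
  have hp' := hp x (Ioo_subset_Icc_self hx)
  have hq' := hq x (Ioo_subset_Icc_self hx)
  have ev : ∀ r : ℝ[X], (r.map (algebraMap ℝ ℂ)).eval (x : ℂ) = ((r.eval x : ℝ) : ℂ) := fun r => by
    rw [eval_map_algebraMap]
    exact Polynomial.aeval_algebraMap_apply_eq_algebraMap_eval x r
  have e : g x - (p.map (algebraMap ℝ ℂ) + C Complex.I * q.map (algebraMap ℝ ℂ)).eval (x : ℂ)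
      = (((g x).re - p.eval x : ℝ) : ℂ) + Complex.I * (((g x).im - q.eval x : ℝ) : ℂ) := by
    rw [eval_add, eval_mul, eval_C, ev, ev]
    conv_lhs => rw [← Complex.re_add_im (g x)]
    push_cast
    ring
  rw [e]
  refine (norm_add_le _ _).trans ?_
  rw [norm_mul, Complex.norm_I, one_mul, Complex.norm_real, Complex.norm_real, Real.norm_eq_abs,
    Real.norm_eq_abs, abs_sub_comm, abs_sub_comm (g x).im]
  linarith

/-- Bounded continuous functions are dense in L², and polynomials approximate them uniformly; on an
interval of length 2 the L² norm is at most √2 ≤ 2 times the uniform bound. -/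
lemma polyL2_dense : (LinearMap.range polyL2).topologicalClosure = ⊤ := by
  rw [← Submodule.dense_iff_topologicalClosure_eq_top]
  intro u
  rw [Metric.mem_closure_iff]
  intro ε hε
  have hu : MemLp u 2 μI := Lp.memLp u
  obtain ⟨g, hg, hgL⟩ := hu.exists_boundedContinuous_eLpNorm_sub_le (by norm_num)
    (ε := ENNReal.ofReal (ε / 4)) (by simpa using hε)
  obtain ⟨q, hq⟩ := exists_polynomial_near g.continuous (ε := ε / 4) (by linarith)
  refine ⟨polyL2 q, ⟨q, rfl⟩, ?_⟩
  have h1 : dist u (MemLp.toLp g hgL) ≤ ε / 4 := by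
    rw [Lp.dist_def]
    refine ENNReal.toReal_le_of_le_ofReal (by linarith) ((eLpNorm_congr_ae ?_).trans_le hg)
    exact (EventuallyEq.refl _ _).sub (MemLp.coeFn_toLp hgL)
  have h2 : dist (MemLp.toLp g hgL) (polyL2 q) ≤ 2 * (ε / 4) := by
    rw [dist_eq_norm]
    have hb : ∀ᵐ x ∂μI, ‖(MemLp.toLp g hgL - polyL2 q : L2) x‖ ≤ ε / 4 := by
      filter_upwards [Lp.coeFn_sub (MemLp.toLp g hgL) (polyL2 q), MemLp.coeFn_toLp hgL,
        polyL2_ae q, ae_restrict_mem measurableSet_Ioo] with x e1 e2 e3 hx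
      rw [e1, Pi.sub_apply, e2, e3]
      exact hq x hx
    refine (Lp.norm_le_of_ae_bound (by linarith) hb).trans ?_
    refine mul_le_mul_of_nonneg_right ?_ (by linarith)
    have hvol : measureUnivNNReal μI = 2 := by
      rw [measureUnivNNReal, Measure.restrict_apply_univ, Real.volume_Ioo]
      rw [show (1 - (-1) : ℝ) = 2 by norm_num, ENNReal.ofReal, ENNReal.toNNReal_coe]
      exact Real.toNNReal_ofNat 2
    rw [hvol]
    have : ((2 : NNReal) ^ (2 : ENNReal).toReal⁻¹ : NNReal) ≤ 2 ^ (1 : ℝ) :=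
      NNReal.rpow_le_rpow_of_exponent_le (by norm_num) (by norm_num)
    rw [NNReal.rpow_one] at this
    exact_mod_cast this
  linarith [dist_triangle u (MemLp.toLp g hgL) (polyL2 q)]

lemma legendreL2_dense :
    (Submodule.span ℂ (range legendreL2)).topologicalClosure = ⊤ := by
  rw [span_legendreL2, polyL2_dense]

/-! ### The Legendre basis -/

/-- Eigenvectors of a symmetric operator for the distinct eigenvalues m(m+1) and n(n+1). -/
lemma legendreL2_orthogonal {m n : ℕ} (h : m ≠ n) :
    inner ℂ (legendreL2 m) (legendreL2 n) = (0 : ℂ) := by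
  obtain ⟨hm, em⟩ := opA_legendreL2 m
  obtain ⟨hn, en⟩ := opA_legendreL2 n
  have := opA_symmetric ⟨_, hm⟩ ⟨_, hn⟩
  rw [em, en, inner_smul_left, inner_smul_right] at this
  have h1 : ((m : ℂ) * (m + 1)) ≠ (n : ℂ) * (n + 1) := by
    intro e
    have e' : m * (m + 1) = n * (n + 1) := by exact_mod_cast e
    rcases lt_or_gt_of_ne h with h | h <;> nlinarith
  have h2 : (starRingEnd ℂ) ((m : ℂ) * (m + 1)) = (m : ℂ) * (m + 1) := by simp
  rw [h2, ← sub_eq_zero, ← sub_mul] at this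
  exact (mul_eq_zero.1 this).resolve_left (sub_ne_zero.2 h1)

lemma orthonormal_legendre :
    Orthonormal ℂ (fun n => ((‖legendreL2 n‖⁻¹ : ℝ) : ℂ) • legendreL2 n) := by
  refine ⟨fun n => ?_, fun m n h => ?_⟩
  · rw [norm_smul, Complex.norm_real, norm_inv, norm_norm,
      inv_mul_cancel₀ (norm_ne_zero_iff.2 (legendreL2_ne_zero n))]
  · change inner ℂ (_ • _) (_ • _) = _
    rw [inner_smul_left, inner_smul_right, legendreL2_orthogonal h, mul_zero, mul_zero]

/-- The Hilbert basis of normalised Legendre polynomials. -/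
def legendreBasis : HilbertBasis ℕ ℂ L2 := HilbertBasis.mk orthonormal_legendre <| by
  rw [← legendreL2_dense]
  refine Submodule.topologicalClosure_mono (Submodule.span_le.2 (range_subset_iff.2 fun n => ?_))
  have h := Submodule.smul_mem _ (‖legendreL2 n‖ : ℂ) (Submodule.subset_span (R := ℂ)
    (mem_range_self (f := fun n => ((‖legendreL2 n‖⁻¹ : ℝ) : ℂ) • legendreL2 n) n))
  rwa [smul_smul, ← Complex.ofReal_mul,
    mul_inv_cancel₀ (norm_ne_zero_iff.2 (legendreL2_ne_zero n)), Complex.ofReal_one,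
    one_smul] at h

lemma legendreBasis_apply (n : ℕ) :
    legendreBasis n = ((‖legendreL2 n‖⁻¹ : ℝ) : ℂ) • legendreL2 n :=
  congrFun (HilbertBasis.coe_mk _ _) n

lemma exists_legendreL2_eq_smul (n : ℕ) : ∃ a : ℂ, legendreL2 n = a • legendreBasis n := by
  refine ⟨‖legendreL2 n‖, ?_⟩
  rw [legendreBasis_apply, smul_smul, ← Complex.ofReal_mul,
    mul_inv_cancel₀ (norm_ne_zero_iff.2 (legendreL2_ne_zero n)), Complex.ofReal_one, one_smul]

lemma opA_legendreBasis (n : ℕ) : ∃ h : legendreBasis n ∈ opA.domain,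
    opA ⟨legendreBasis n, h⟩ = ((n * (n + 1) : ℝ) : ℂ) • legendreBasis n := by
  obtain ⟨h, e⟩ := opA_legendreL2 n
  have hm : legendreBasis n ∈ opA.domain := by
    rw [legendreBasis_apply]
    exact opA.domain.smul_mem _ h
  refine ⟨hm, ?_⟩
  have e1 : (⟨legendreBasis n, hm⟩ : opA.domain)
      = ((‖legendreL2 n‖⁻¹ : ℝ) : ℂ) • ⟨legendreL2 n, h⟩ := Subtype.ext (legendreBasis_apply n)
  rw [e1, opA.map_smul, e, legendreBasis_apply, smul_comm]
  push_cast
  rfl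

/-- Symmetry gives the coordinate relation on the domain. Maximality is the substantial half, and it
comes from solving A w = v explicitly. -/
lemma isDiagonal_opA : IsDiagonal opA legendreBasis (fun n => n * (n + 1)) := by
  have key : ∀ (u : opA.domain) (n : ℕ), inner ℂ (legendreBasis n) (opA u)
      = ((n * (n + 1) : ℝ) : ℂ) * inner ℂ (legendreBasis n) (u : L2) := by
    intro u n
    obtain ⟨h, e⟩ := opA_legendreBasis n
    rw [← opA_symmetric ⟨_, h⟩ u, e, inner_smul_left, Complex.conj_ofReal]
  intro u v
  constructor
  · rintro ⟨h, rfl⟩ n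
    exact key ⟨u, h⟩ n
  · intro huv
    have hP0 : legendreP 0 = 1 := by simp [legendreP]
    -- The eigenvalue for n = 0 is 0, so v is orthogonal to P₀ = 1.
    have hv : ∫ x in I, v x = 0 := by
      have h0 := huv 0
      obtain ⟨a, ha⟩ := exists_legendreL2_eq_smul 0
      have h1 : inner ℂ (legendreL2 0) v = (0 : ℂ) := by
        rw [ha, inner_smul_left, h0]
        simp
      rw [← polyL2_legendreP, inner_eq_of_ae (polyL2_ae (legendreP 0)) (EventuallyEq.refl _ v),
        hP0] at h1
      simpa using h1
    obtain ⟨w, hw, rfl⟩ := exists_opA_eq hv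
    obtain ⟨h0, e0⟩ := opA_legendreBasis 0
    set c : ℂ := inner ℂ (legendreBasis 0) (u - w) with hc
    -- For n ≥ 1 the eigenvalue is nonzero, so u and w share those coordinates and differ only along
    -- the constants, which lie in the kernel of A.
    have hu : u = w + c • legendreBasis 0 := by
      refine hilbertBasis_ext legendreBasis fun n => ?_
      rw [inner_add_right, inner_smul_right, inner_hilbertBasis]
      rcases n with _ | n
      · simp [hc, inner_sub_right]
      · have e1 := (key ⟨w, hw⟩ (n + 1)).symm.trans (huv (n + 1))
        have hne : (((n + 1 : ℕ) * ((n + 1 : ℕ) + 1) : ℝ) : ℂ) ≠ 0 := by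
          exact Complex.ofReal_ne_zero.2 (by positivity)
        rw [if_neg (Nat.succ_ne_zero n), mul_zero, add_zero]
        exact (mul_left_cancel₀ hne e1).symm
    have hmem : u ∈ opA.domain := by
      rw [hu]
      exact opA.domain.add_mem hw (opA.domain.smul_mem c h0)
    refine ⟨hmem, ?_⟩
    have e1 : (⟨u, hmem⟩ : opA.domain) = ⟨w, hw⟩ + c • ⟨legendreBasis 0, h0⟩ := Subtype.ext hu
    rw [e1, opA.map_add, opA.map_smul, e0]
    simp

lemma isDiagonal_opT : IsDiagonal opT legendreBasis (fun n => ((n : ℝ) * (n + 1)) ^ 2) :=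
  isDiagonal_opA.square

/-- The eigenvalues are distinct integers. -/
lemma eigenvalue_separated (m n : ℕ) (h : m ≠ n) :
    1 ≤ |((m : ℝ) * (m + 1)) ^ 2 - ((n : ℝ) * (n + 1)) ^ 2| := by
  have hz : (((m : ℤ) * (m + 1)) ^ 2 - ((n : ℤ) * (n + 1)) ^ 2) ≠ 0 := by
    intro e
    have e' : (m * (m + 1)) ^ 2 = (n * (n + 1)) ^ 2 := by exact_mod_cast sub_eq_zero.1 e
    have e2 := Nat.pow_left_injective two_ne_zero e'
    rcases lt_or_gt_of_ne h with h | h <;> nlinarith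
  exact_mod_cast Int.one_le_abs hz

lemma opT_legendreL2 (n : ℕ) : ∃ h : legendreL2 n ∈ opT.domain,
    opT ⟨legendreL2 n, h⟩ = ((n : ℂ) ^ 2 * ((n : ℂ) + 1) ^ 2) • legendreL2 n := by
  refine (isDiagonal_opT _ _).2 fun m => ?_
  obtain ⟨a, ha⟩ := exists_legendreL2_eq_smul n
  rw [ha, inner_smul_right, inner_smul_right, inner_hilbertBasis]
  split_ifs with h
  · subst h
    push_cast
    ring
  · simp

end LegendreSquare

end

theorem theorem4p4 :
    -- the four descriptions of the domain of `T = A²`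
    (∀ f : ℝ → ℂ, List.TFAE
      [ f ∈ LegendreSquare.domASq,
        LegendreSquare.ACLocUpTo 3 f ∧
          LegendreSquare.SqInt (fun x : ℝ => (1 - (x : ℂ) ^ 2) ^ 2 * iteratedDeriv 4 f x),
        f ∈ LegendreSquare.maxDomain₂ ∧
          LegendreSquare.VanishesAtEnds (LegendreSquare.form₂ f (fun _ => 1)) ∧
          LegendreSquare.VanishesAtEnds (LegendreSquare.form₂ f (fun x => (x : ℂ))),
        f ∈ LegendreSquare.maxDomain₂ ∧
          LegendreSquare.VanishesAtEnds (fun x : ℝ => (1 - (x : ℂ) ^ 2) * deriv f x) ∧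
          LegendreSquare.VanishesAtEnds
            (deriv (fun x : ℝ => (1 - (x : ℂ) ^ 2) ^ 2 * iteratedDeriv 2 f x)) ]) ∧
    -- `D(T)` consists of the classes of these functions, and `T f = ℓ²[f]`
    (∀ u : LegendreSquare.L2, u ∈ LegendreSquare.opT.domain ↔
      ∃ f ∈ LegendreSquare.domASq, u =ᵐ[LegendreSquare.μI] f) ∧
    (∀ (u : LegendreSquare.opT.domain), ∀ f ∈ LegendreSquare.domASq,
      (u : LegendreSquare.L2) =ᵐ[LegendreSquare.μI] f →
        LegendreSquare.opT u =ᵐ[LegendreSquare.μI] LegendreSquare.ellSq f) ∧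
    -- `T` is self-adjoint
    IsSelfAdjoint LegendreSquare.opT ∧
    -- the Legendre polynomials are a complete set of eigenfunctions
    (∀ n : ℕ, LegendreSquare.legendreL2 n ≠ 0 ∧
      ∃ h : LegendreSquare.legendreL2 n ∈ LegendreSquare.opT.domain,
        LegendreSquare.opT ⟨LegendreSquare.legendreL2 n, h⟩ =
          ((n : ℂ) ^ 2 * ((n : ℂ) + 1) ^ 2) • LegendreSquare.legendreL2 n) ∧
    (Submodule.span ℂ (Set.range LegendreSquare.legendreL2)).topologicalClosure = ⊤ ∧
    -- the spectrum
    LegendreSquare.HasDiscreteSpectrum LegendreSquare.opT ∧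
    LegendreSquare.spectrumOf LegendreSquare.opT =
      Set.range (fun n : ℕ => (n : ℂ) ^ 2 * ((n : ℂ) + 1) ^ 2) := by
  refine ⟨LegendreSquare.domASq_tfae, LegendreSquare.mem_opT_domain_iff,
    fun u f hf hu => LegendreSquare.opT_apply u hf hu,
    LegendreSquare.isDiagonal_opT.isSelfAdjoint,
    fun n => ⟨LegendreSquare.legendreL2_ne_zero n, LegendreSquare.opT_legendreL2 n⟩,
    LegendreSquare.legendreL2_dense,
    LegendreSquare.isDiagonal_opT.hasDiscreteSpectrum LegendreSquare.eigenvalue_separated, ?_⟩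
  rw [LegendreSquare.isDiagonal_opT.spectrumOf_eq LegendreSquare.eigenvalue_separated]
  congr 1
  funext n
  push_cast
  ring
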